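/- Let $F$ be a set of functions $\mathbb R\to\mathbb R$ (activations) that contains $\mathrm{ReLU}(x)=\max\{0,x\}$ and whose elements are referred to by pairwise distinct binary strings. An $F$-network $N$ consists of $n$ input nodes followed by at least one layer of computation nodes, the last of which is the output layer with $m$ nodes; a computation node (in the output layer, too) outputs $\sigma\big(\sum_j c_j y_j+b\big)$, where $\sigma\in F$, the weights $c_j$ and the bias $b$ are rational, and the $y_j$ are the outputs of all nodes of the previous layer. So $N$ computes a function $N:\mathbb R^n\to\mathbb R^m$. For $p\in[1,\infty]$ let $d_p$ be the metric induced by the $p$-norm (on $\mathbb R^n$ and on $\mathbb R^m$). For $\bar x\in\mathbb Q^n$, $\varepsilon,\delta\in\mathbb Q_{\ge 0}\cup\{\infty\}$ and $1\le j\le m$ consider the decision problems - $\mathrm{CR}_{d}(F)$, with instances $(N,\varepsilon,\bar x,j)$: is it true that for all $x\in\mathbb R^n$ with $d(x,\bar x)\le\varepsilon$ the $j$-th output is maximal, i.e. $N(x)_i\le N(x)_j$ for all $i$? - $\mathrm{aCR}_{d}(F)$, with instances $(N,\varepsilon,\bar x)$: is there a $j\in\{1,\dots,m\}$ such that $\mathrm{CR}_d(F)$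 holds for $(N,\varepsilon,\bar x,j)$? - $\mathrm{SR}_{d}(F)$, with instances $(N,\varepsilon,\delta,\bar x)$: is it true that $d(N(\bar x),N(x))\le\delta$ for all $x\in\mathbb R^n$ with $d(x,\bar x)\le\varepsilon$? Rational numbers are written in binary as reduced fractions, and networks as lists of layers of nodes. Then for every $d\in\{d_1,d_\infty\}$ and every (real or infinite) $\lambda\in[1,\infty]$, there are polynomial-time many-one reductions, in the Turing model, from $\mathrm{CR}_d(F)$ to $\mathrm{CR}_{d_\lambda}(F)$, from $\mathrm{aCR}_d(F)$ to $\mathrm{aCR}_{d_\lambda}(F)$, and from $\mathrm{SR}_d(F)$ to $\mathrm{SR}_{d_\lambda}(F)$. -/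

import Mathlib

namespace NeuralNet

open scoped ENNReal

/-- The rectified linear unit `x ↦ max 0 x`. -/
noncomputable def relu (x : ℝ) : ℝ := max 0 x

/-- A computation node with `n` incoming connections: its activation, its bias and its weights.
`A` is the set of admissible activations. -/
structure Neuron (A : Type) (n : ℕ) where
  act : A
  bias : ℚ
  weight : Fin n → ℚ

/-- A feedforward network with `n` input nodes and `m` output nodes: a nonempty sequence of layers of
computation nodes, the last of which is the output layer. Every layer is a family of neurons that
receive the outputs of all nodes of the previous layer (of the input nodes, for the first one). -/
inductive Net (A : Type) : ℕ → ℕ → Type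
  | output {n m : ℕ} (layer : Fin m → Neuron A n) : Net A n m
  | hidden {n k m : ℕ} (layer : Fin k → Neuron A n) (rest : Net A k m) : Net A n m

section Semantics

variable {F : Set (ℝ → ℝ)}

/-- The output `σ (∑ j, c j * y j + b)` of a neuron with activation `σ ∈ F`. -/
noncomputable def Neuron.eval {n : ℕ} (u : Neuron F n) (y : Fin n → ℝ) : ℝ :=
  (u.act : ℝ → ℝ) (∑ j, (u.weight j : ℝ) * y j + (u.bias : ℝ))

/-- The function `ℝⁿ → ℝᵐ` computed by a network. -/
noncomputable def Net.eval : {n m : ℕ} → Net F n m → (Fin n → ℝ) → (Fin m → ℝ)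
  | _, _, .output layer, x => fun i => (layer i).eval x
  | _, _, .hidden layer rest, x => rest.eval (fun i => (layer i).eval x)

end Semantics

/-- The metric `d_p` on `ℝⁿ` induced by the `p`-norm. -/
noncomputable def lpDist (p : ℝ≥0∞) {n : ℕ} (x y : Fin n → ℝ) : ℝ :=
  dist (WithLp.toLp p x) (WithLp.toLp p y)

/-- `r ≤ t` for a real `r` and a tolerance `t ∈ ℚ≥0 ∪ {∞}`. -/
def WithinTol (r : ℝ) (t : WithTop ℚ≥0) : Prop :=
  ∀ q : ℚ≥0, t = (q : WithTop ℚ≥0) → r ≤ (q : ℝ)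

/-- A rational point, regarded as a point of `ℝⁿ`. -/
def realPoint {n : ℕ} (c : Fin n → ℚ) : Fin n → ℝ := fun i => (c i : ℝ)

/-- Instances `(N, ε, x̄, j)` of classification robustness. -/
structure CRInstance (A : Type) where
  {inDim : ℕ}
  {outDim : ℕ}
  net : Net A inDim outDim
  eps : WithTop ℚ≥0
  center : Fin inDim → ℚ
  label : Fin outDim

/-- Instances `(N, ε, x̄)` of arbitrary classification robustness. -/
structure ACRInstance (A : Type) where
  {inDim : ℕ}
  {outDim : ℕ}
  net : Net A inDim outDim
  eps : WithTop ℚ≥0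
  center : Fin inDim → ℚ

/-- Instances `(N, ε, δ, x̄)` of standard robustness. -/
structure SRInstance (A : Type) where
  {inDim : ℕ}
  {outDim : ℕ}
  net : Net A inDim outDim
  eps : WithTop ℚ≥0
  delta : WithTop ℚ≥0
  center : Fin inDim → ℚ

section Problems

variable {F : Set (ℝ → ℝ)}

/-- Every input that is `ε`-close to `c` with respect to `d_p` has classification `j`, that is,
the `j`-th output is a maximal one. -/
def ClassRobust (p : ℝ≥0∞) {n m : ℕ} (N : Net F n m) (ε : WithTop ℚ≥0) (c : Fin n → ℚ)
    (j : Fin m) : Prop :=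
  ∀ x : Fin n → ℝ, WithinTol (lpDist p x (realPoint c)) ε → ∀ i, N.eval x i ≤ N.eval x j

/-- The decision problem `CR` with respect to `d_p`. -/
def CR (p : ℝ≥0∞) (I : CRInstance F) : Prop :=
  ClassRobust p I.net I.eps I.center I.label

/-- The decision problem `aCR` with respect to `d_p`. -/
def ACR (p : ℝ≥0∞) (I : ACRInstance F) : Prop :=
  ∃ j, ClassRobust p I.net I.eps I.center j

/-- The decision problem `SR` with respect to `d_p`. -/
def SR (p : ℝ≥0∞) (I : SRInstance F) : Prop :=
  ∀ x : Fin I.inDim → ℝ, WithinTol (lpDist p x (realPoint I.center)) I.eps →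
    WithinTol (lpDist p (I.net.eval (realPoint I.center)) (I.net.eval x)) I.delta

end Problems

/-- The finite alphabet in which instances are written. -/
inductive Sym
  | bit (b : Bool)
  | plus
  | minus
  | slash
  | comma
  | infty
  | close
  | finish

/-- Binary notation of a natural number, least significant digit first. -/
def encNat (k : ℕ) : List Sym := k.bits.map Sym.bit

/-- A rational number as a sign, numerator and denominator of the reduced fraction in binary,
and a terminator. -/
def encRat (q : ℚ) : List Sym :=
  (if q < 0 then Sym.minus else Sym.plus) :: encNat q.num.natAbs ++ Sym.slash :: encNat q.den ++
    [Sym.comma]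

def encTol : WithTop ℚ≥0 → List Sym
  | ⊤ => [Sym.infty]
  | (q : ℚ≥0) => encRat (q : ℚ)

def encVec {n : ℕ} (v : Fin n → ℚ) : List Sym :=
  (List.ofFn v).flatMap encRat ++ [Sym.close]

section Encoding

/-! `name` assigns to every activation the binary string by which it is referred to. -/

variable {A : Type} (name : A → List Bool)

def encNeuron {n : ℕ} (u : Neuron A n) : List Sym :=
  (name u.act).map Sym.bit ++ Sym.comma :: encRat u.bias ++ encVec u.weight

def encLayer {n k : ℕ} (layer : Fin k → Neuron A n) : List Sym :=
  (List.ofFn layer).flatMap (encNeuron name) ++ [Sym.close]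

def encNet : {n m : ℕ} → Net A n m → List Sym
  | _, _, .output layer => encLayer name layer ++ [Sym.finish]
  | _, _, .hidden layer rest => encLayer name layer ++ encNet rest

def encCR (I : CRInstance A) : List Sym :=
  encVec I.center ++ encTol I.eps ++ encNet name I.net ++ encNat I.label

def encACR (I : ACRInstance A) : List Sym :=
  encVec I.center ++ encTol I.eps ++ encNet name I.net

def encSR (I : SRInstance A) : List Sym :=
  encVec I.center ++ encTol I.eps ++ encTol I.delta ++ encNet name I.net

end Encoding

/-- Polynomial-time many-one reducibility of the decision problem `P`, with instances of type `α`
written as strings by `ea`, to the decision problem `Q`, with instances of type `β` written as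
strings by `eb`: some function that maps instances of `P` to equivalent instances of `Q` is computed
by a Turing machine in polynomial time. -/
def PolyTimeReducible {α β : Type} (ea : α → List Sym) (P : α → Prop) (eb : β → List Sym)
    (Q : β → Prop) : Prop :=
  ∃ f : α → β, Nonempty (Turing.TM2ComputableInPolyTime ea eb f) ∧ ∀ a, P a ↔ Q (f a)

end NeuralNet

/-! ### Structured stack programs and their compilation to Turing machines. -/

namespace NeuralNet

open Function Turing

/-! The source metric is built into the network. For `d₁` and `d_∞` there is a piecewise linear map
of `ℝⁿ` onto the closed ball of radius `ε` about `0` that fixes every point of that ball, and three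
layers of ReLU nodes compute it. Composing it, shifted by the center, with `N` turns "for all `x` in
the ball" into "for all `x`" (`forall_withinTol`). The new instance has tolerance `∞`, so the target
metric no longer constrains the inputs.

For `d_∞` each coordinate is clamped to `[-ε, ε]` (`point_box`). For `d₁` the coordinates are served
one after the other from a budget `ε`: with `S` the sum of the preceding absolute values, coordinate
`k` keeps its sign and gets absolute value `relu (ε - S) - relu (ε - S - |x_k|)`. These values
telescope to at most `ε`, and equal `|x_k|` if `x` lies in the ball (`point_cross`,
`abs_point_cross`). Since ReLU nodes have no negative outputs, a real number is passed on as its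
positive and negative part, and the first layer of `N` takes the difference.

In standard robustness the metric also acts on the outputs. Two interleaved copies of `N` compute
`N(x)` and `N(x̄)`, and a comparison network reduces them to one number: the `d₁` distance, with `δ`
kept, or, for `d_∞`, the sum of `relu (±(aᵢ - bᵢ) - δ)`, which is `0` iff the distance is at most
`δ`, so that the new tolerance is `0` (`withinTol_excess`). In dimension one all `p`-norms agree
(`lpDist_fin_one`).

For the time bound, the encodings are rewritten by structured programs on finitely many stacks.
`Run` carries stacks and step bounds, and `Run.reachesIn` transfers it to the stack machine. All new
weight matrices are banded, with rows that unary counters can write, and the rewriting takes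
quadratic time (`run_class`, `run_std`). -/

instance : Fintype Sym where
  elems := ⟨↑[Sym.bit true, .bit false, .plus, .minus, .slash, .comma, .infty, .close, .finish],
    by simp⟩
  complete s := by rcases s with (_ | _) | _ <;> simp

/-- Structured programs acting on finitely many stacks of symbols, indexed by `K`. -/
inductive Prog (K : Type)
  /-- pushes the symbols of `s`, from first to last -/
  | push (k : K) (s : List Sym)
  /-- pops a symbol and branches on it -/
  | pop (k : K) (next : Option Sym → Prog K)
  | seq (p q : Prog K)
  /-- pops symbols `s` and runs `body s`, until the stack is empty or `halts s` holds -/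
  | loop (k : K) (halts : Sym → Bool) (body : Sym → Prog K)

infixr:60 " ;; " => Prog.seq

namespace Prog

variable {K : Type} [DecidableEq K]

/-- `S` with the symbols of `s` pushed on stack `k`, from first to last. -/
def app (S : K → List Sym) (k : K) (s : List Sym) : K → List Sym :=
  update S k (s.reverse ++ S k)

/-- `Run p S t S'`: started with stacks `S`, the program `p` ends with stacks `S'` after at
most `t` steps. -/
inductive Run : Prog K → (K → List Sym) → ℕ → (K → List Sym) → Prop
  | push {k s S} : Run (push k s) S 1 (app S k s)
  | pop {k next S t S'} (h : Run (next (S k).head?) (update S k (S k).tail) t S') :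
      Run (pop k next) S (t + 1) S'
  | seq {p q S S' S'' t t'} (h : Run p S t S') (h' : Run q S' t' S'') : Run (p ;; q) S (t + t') S''
  | loop_exit {k halts body S} (h : ∀ s ∈ (S k).head?, halts s) :
      Run (loop k halts body) S 1 (update S k (S k).tail)
  | loop_step {k halts body S s l S' S'' t t'} (hk : S k = s :: l) (hs : halts s = false)
      (h : Run (body s) (update S k l) t S') (h' : Run (loop k halts body) S' t' S'') :
      Run (loop k halts body) S (t + t' + 1) S''
  | mono {p S t t' S'} (h : Run p S t S') (ht : t ≤ t') : Run p S t' S'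

/-- The control states of a program. -/
def Lab : Prog K → Type
  | push _ _ => Unit
  | pop _ next => Unit ⊕ Σ o, Lab (next o)
  | seq p q => Lab p ⊕ Lab q
  | loop _ _ body => Unit ⊕ Σ s, Lab (body s)

/-- The initial control state of a program. -/
def entry : (p : Prog K) → Lab p
  | push _ _ => ()
  | pop _ _ => .inl ()
  | seq p _ => .inl (entry p)
  | loop _ _ _ => .inl ()

omit [DecidableEq K] in
theorem finite_lab (p : Prog K) : Finite (Lab p) := by
  induction p with
  | push => exact inferInstanceAs (Finite Unit)
  | pop k next ih => exact inferInstanceAs (Finite (Unit ⊕ Σ o, Lab (next o)))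
  | seq p q ihp ihq => exact inferInstanceAs (Finite (Lab p ⊕ Lab q))
  | loop k halts body ih => exact inferInstanceAs (Finite (Unit ⊕ Σ s, Lab (body s)))

/-- The stack machine code of a program whose control states are embedded by `emb`, and that
continues at `exit`. -/
def code {Λ : Type} : (p : Prog K) → (Lab p → Λ) → Λ → Lab p →
    TM2.Stmt (fun _ : K => Sym) Λ (Option Sym)
  | push k s, _, exit, _ => s.foldr (fun a q => .push k (fun _ => a) q) (.goto fun _ => exit)
  | pop k next, emb, exit, l =>
    match l with
    | .inl _ => .pop k (fun _ o => o) (.goto fun o => emb (.inr ⟨o, entry (next o)⟩))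
    | .inr ⟨o, l⟩ => code (next o) (fun l => emb (.inr ⟨o, l⟩)) exit l
  | seq p q, emb, exit, l =>
    match l with
    | .inl l => code p (fun l => emb (.inl l)) (emb (.inr (entry q))) l
    | .inr l => code q (fun l => emb (.inr l)) exit l
  | loop k halts body, emb, exit, l =>
    match l with
    | .inl _ => .pop k (fun _ o => o) (.goto fun o =>
        match o with
        | none => exit
        | some s => if halts s then exit else emb (.inr ⟨s, entry (body s)⟩))
    | .inr ⟨s, l⟩ => code (body s) (fun l => emb (.inr ⟨s, l⟩)) (emb (.inl ())) l

theorem stepAux_pushes {Λ : Type} (k : K) (exit : Λ) (v : Option Sym) (s : List Sym)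
    (S : K → List Sym) :
    TM2.stepAux (s.foldr (fun a q => TM2.Stmt.push (Γ := fun _ : K => Sym) k (fun _ => a) q)
      (.goto fun _ => exit)) v S = ⟨some exit, v, app S k s⟩ := by
  induction s generalizing S with
  | nil => simp [app]
  | cons a s ih => simp [ih, app]

/-- Reachability in at most `t` steps. -/
def ReachesIn {Λ : Type} (M : Λ → TM2.Stmt (fun _ : K => Sym) Λ (Option Sym)) (t : ℕ)
    (c c' : TM2.Cfg (fun _ : K => Sym) Λ (Option Sym)) : Prop :=
  ∃ n ≤ t, (flip bind (TM2.step M))^[n] (some c) = some c'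

theorem ReachesIn.trans {Λ : Type} {M : Λ → TM2.Stmt (fun _ : K => Sym) Λ (Option Sym)}
    {t t' : ℕ} {a b c : TM2.Cfg (fun _ : K => Sym) Λ (Option Sym)} (h : ReachesIn M t a b)
    (h' : ReachesIn M t' b c) : ReachesIn M (t + t') a c := by
  obtain ⟨n, hn, h⟩ := h
  obtain ⟨n', hn', h'⟩ := h'
  exact ⟨n' + n, by omega, by rw [iterate_add_apply, h, h']⟩

theorem ReachesIn.single {Λ : Type} {M : Λ → TM2.Stmt (fun _ : K => Sym) Λ (Option Sym)}
    {a b : TM2.Cfg (fun _ : K => Sym) Λ (Option Sym)} (h : TM2.step M a = some b) :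
    ReachesIn M 1 a b :=
  ⟨1, le_rfl, h⟩

/-- Induction on the run, with the exit generalized because a loop body is compiled with the loop
head as its exit. The final register content is left open: every `pop` overwrites the register
before branching on it. -/
theorem Run.reachesIn {p : Prog K} {S S' : K → List Sym} {t : ℕ} (h : Run p S t S') {Λ : Type}
    {M : Λ → TM2.Stmt (fun _ : K => Sym) Λ (Option Sym)} {emb : Lab p → Λ} {exit : Λ}
    (hM : ∀ l, M (emb l) = code p emb exit l) (v : Option Sym) :
    ∃ v', ReachesIn M t ⟨some (emb (entry p)), v, S⟩ ⟨some exit, v', S'⟩ := by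
  induction h generalizing exit v with
  | push =>
    refine ⟨v, .single ?_⟩
    rw [TM2.step, hM, code, stepAux_pushes]
  | @pop k next S t S' h ih =>
    obtain ⟨v', h'⟩ := ih (emb := fun l => emb (.inr ⟨(S k).head?, l⟩)) (exit := exit)
      (fun l => hM (.inr ⟨_, l⟩)) (S k).head?
    refine ⟨v', ?_⟩
    rw [add_comm]
    refine ReachesIn.trans (.single ?_) h'
    rw [TM2.step, hM]
    rfl
  | @seq p q S S' S'' t t' h h' ih ih' =>
    obtain ⟨v', h₁⟩ := ih (emb := fun l => emb (.inl l)) (exit := emb (.inr (entry q)))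
      (fun l => hM (.inl l)) v
    obtain ⟨v'', h₂⟩ := ih' (emb := fun l => emb (.inr l)) (exit := exit)
      (fun l => hM (.inr l)) v'
    exact ⟨v'', h₁.trans h₂⟩
  | @loop_exit k halts body S h =>
    refine ⟨(S k).head?, .single ?_⟩
    rw [TM2.step, hM]
    simp only [code, entry, TM2.stepAux]
    rcases hk : (S k).head? with _ | s
    · rfl
    · simp [h s hk]
  | @loop_step k halts body S s l S' S'' t t' hk hs h h' ih ih' =>
    obtain ⟨v', h₁⟩ := ih (emb := fun l => emb (.inr ⟨s, l⟩)) (exit := emb (.inl ()))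
      (fun l => hM (.inr ⟨s, l⟩)) (some s)
    obtain ⟨v'', h₂⟩ := ih' hM v'
    refine ⟨v'', ?_⟩
    rw [add_comm]
    refine ReachesIn.trans (.single ?_) (h₁.trans h₂)
    rw [TM2.step, hM]
    simp [code, entry, hk, hs]
  | mono h ht ih =>
    obtain ⟨v', n, hn, h'⟩ := ih hM v
    exact ⟨v', n, hn.trans ht, h'⟩

/-- The stack machine that runs a program and halts. -/
noncomputable def machine [Fintype K] (inp out : K) (p : Prog K) : FinTM2 where
  K := K
  k₀ := inp
  k₁ := out
  Γ := fun _ => Sym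
  Λ := Option (Lab p)
  main := some (entry p)
  ΛFin := haveI := finite_lab p; Fintype.ofFinite _
  σ := Option Sym
  initialState := none
  Γk₀Fin := inferInstanceAs (Fintype Sym)
  m
    | none => .load (fun _ => none) .halt
    | some l => code p some none l

/-- The stacks that are empty but for the `k`-th one. -/
def only (k : K) (s : List Sym) : K → List Sym := update (fun _ => []) k s

/-- The step added by `time + 1` is taken at the exit label `none`, where the register is reset so
that the final configuration is exactly `haltList`. -/
theorem nonempty_polyTime [Fintype K] {α β : Type} {ea : α → List Sym} {eb : β → List Sym}
    {f : α → β} (inp out : K) (p : Prog K) (time : Polynomial ℕ)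
    (h : ∀ a, Run p (only inp (ea a)) (time.eval (ea a).length) (only out (eb (f a)))) :
    Nonempty (TM2ComputableInPolyTime ea eb f) := by
  have key : ∀ a, ∃ n ≤ (time + 1).eval (ea a).length,
      (flip bind (machine inp out p).step)^[n] (some (initList (machine inp out p)
        ((ea a).map (Equiv.refl Sym).invFun))) =
        some (haltList (machine inp out p) ((eb (f a)).map (Equiv.refl Sym).invFun)) := by
    intro a
    obtain ⟨v', h₁⟩ := (h a).reachesIn (M := (machine inp out p).m) (emb := some) (exit := none)
      (fun l => rfl) none
    obtain ⟨n, hn, h₂⟩ := h₁.trans (ReachesIn.single (b := ⟨none, none, _⟩) rfl)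
    refine ⟨n, by simpa using hn, ?_⟩
    have e₁ : initList (machine inp out p) ((ea a).map (Equiv.refl Sym).invFun) =
        ⟨some (some (entry p)), none, only inp (ea a)⟩ := by
      simp only [initList]
      congr 1
      refine funext fun (k : K) => ?_
      change (if h : k = inp then _ else _) = _
      by_cases hk : k = inp
      · subst hk
        rw [dif_pos rfl]
        exact (List.map_id _).trans (update_self k (ea a) fun _ => []).symm
      · rw [dif_neg hk]
        exact (update_of_ne hk _ (fun _ => [])).symm
    have e₂ : haltList (machine inp out p) ((eb (f a)).map (Equiv.refl Sym).invFun) =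
        ⟨none, none, only out (eb (f a))⟩ := by
      simp only [haltList]
      congr 1
      refine funext fun (k : K) => ?_
      change (if h : k = out then _ else _) = _
      by_cases hk : k = out
      · subst hk
        rw [dif_pos rfl]
        exact (List.map_id _).trans (update_self k (eb (f a)) fun _ => []).symm
      · rw [dif_neg hk]
        exact (update_of_ne hk _ (fun _ => [])).symm
    rw [e₁, e₂]
    exact h₂
  exact ⟨{  tm := machine inp out p
            inputAlphabet := Equiv.refl Sym
            outputAlphabet := Equiv.refl Sym
            time := time + 1
            outputsFun := fun a =>
              { steps := (key a).choose
                evals_in_steps := (key a).choose_spec.2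
                steps_le_m := (key a).choose_spec.1 } }⟩

end Prog
end NeuralNet

/-! ### Copying, negating, repeating and reading strings on stacks. -/

namespace NeuralNet

open Function Turing

namespace Prog

variable {K : Type} [DecidableEq K]

@[simp]
theorem app_same (S : K → List Sym) (k : K) (s : List Sym) : app S k s k = s.reverse ++ S k :=
  update_self ..

theorem app_of_ne {j k : K} (h : j ≠ k) (S : K → List Sym) (s : List Sym) : app S k s j = S j :=
  update_of_ne h ..

@[simp]
theorem app_app (S : K → List Sym) (k : K) (s s' : List Sym) :
    app (app S k s) k s' = app S k (s ++ s') := by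
  simp [app]

@[simp]
theorem app_nil (S : K → List Sym) (k : K) : app S k [] = S := by
  simp [app]

theorem Run.congr {p : Prog K} {S S' S'' : K → List Sym} {t t' : ℕ} (h : Run p S t S')
    (hS : S' = S'') (ht : t ≤ t') : Run p S t' S'' :=
  hS ▸ h.mono ht

/-- `Emits p d S t s`: started with stacks `S`, the program `p` pushes the symbols of `s` on stack
`d` within `t` steps. -/
def Emits (p : Prog K) (d : K) (S : K → List Sym) (t : ℕ) (s : List Sym) : Prop :=
  Run p S t (app S d s)

theorem Emits.seq {p q : Prog K} {d : K} {S : K → List Sym} {t t' : ℕ} {s s' : List Sym}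
    (h : Emits p d S t s) (h' : Emits q d (app S d s) t' s') :
    Emits (p ;; q) d S (t + t') (s ++ s') :=
  (Run.seq h h').congr (app_app ..) le_rfl

theorem emits_push (d : K) (S : K → List Sym) (s : List Sym) : Emits (push d s) d S 1 s :=
  Run.push

theorem Emits.mono {p : Prog K} {d : K} {S : K → List Sym} {t t' : ℕ} {s : List Sym}
    (h : Emits p d S t s) (ht : t ≤ t') : Emits p d S t' s :=
  Run.mono h ht

/-- Moves the content of `a` to `b`, reversing it. -/
def move (a b : K) : Prog K := loop a (fun _ => false) fun s => push b [s]

theorem run_move {a b : K} (hab : a ≠ b) (S : K → List Sym) :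
    Run (move a b) S (2 * (S a).length + 1) (update (app S b (S a)) a []) := by
  induction h : S a generalizing S with
  | nil => exact (Run.loop_exit (by simp [h])).congr (by simp [h]) (by simp)
  | cons s l ih =>
    refine (Run.loop_step h rfl .push (ih _ ?_)).congr ?_ ?_
    · simp [app, hab]
    · ext1 k
      rcases eq_or_ne k a with rfl | hk
      · simp
      · rcases eq_or_ne k b with rfl | hk'
        · simp [app, hk]
        · simp [app, hk, hk']
    · simp; omega

/-- Empties stack `a`. -/
def clear (a : K) : Prog K := loop a (fun _ => false) fun _ => push a []

theorem run_clear (a : K) (S : K → List Sym) :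
    Run (clear a) S (2 * (S a).length + 1) (update S a []) := by
  induction h : S a generalizing S with
  | nil => exact (Run.loop_exit (by simp [h])).congr (by simp [h]) (by simp)
  | cons s l ih =>
    refine (Run.loop_step h rfl .push (ih _ ?_)).congr ?_ ?_
    · simp
    · simp
    · simp; omega

/-- Moves the content of `a` to both `b` and `c`, reversing it. -/
def moveBoth (a b c : K) : Prog K := loop a (fun _ => false) fun s => push b [s] ;; push c [s]

theorem run_moveBoth {a b c : K} (hab : a ≠ b) (hac : a ≠ c) (hbc : b ≠ c) (S : K → List Sym) :
    Run (moveBoth a b c) S (3 * (S a).length + 1)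
      (update (app (app S b (S a)) c (S a)) a []) := by
  induction h : S a generalizing S with
  | nil => exact (Run.loop_exit (by simp [h])).congr (by simp [h]) (by simp)
  | cons s l ih =>
    refine (Run.loop_step h rfl (.seq .push .push) (ih _ ?_)).congr ?_ ?_
    · simp [app, hab, hac]
    · ext1 k
      rcases eq_or_ne k a with rfl | hk
      · simp
      · rcases eq_or_ne k b with rfl | hk'
        · simp [app, hk, hbc]
        · rcases eq_or_ne k c with rfl | hk''
          · simp [app, hk, hk']
          · simp [app, hk, hk', hk'']
    · simp; omega

/-- Pushes the content of `k` on `d`, bottom symbol first. -/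
def copy (k T d : K) : Prog K := move k T ;; moveBoth T k d

/-- A pushed word lies on its stack in reverse. The detour through the empty stack `T` restores `k`
and delivers the word to `d` in its original order. -/
theorem emits_copy {k T d : K} (hT : k ≠ T) (hd : k ≠ d) (hTd : T ≠ d) {S : K → List Sym}
    (hS : S T = []) : Emits (copy k T d) d S (5 * (S k).length + 2) (S k).reverse := by
  refine (Run.seq (run_move hT S) (run_moveBoth hT.symm hTd hd _)).congr ?_ ?_
  · ext1 j
    rcases eq_or_ne j T with rfl | hj
    · simp [app, hTd, hS]
    · rcases eq_or_ne j d with rfl | hj'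
      · simp [app, hj, hd.symm, hT.symm, hS]
      · rcases eq_or_ne j k with rfl | hj''
        · simp [app, hj, hj', hj.symm, hS]
        · simp [app, hj, hj', hj'']
  · simp [app, hT.symm, hS]; omega

/-- The opposite sign. -/
def flipSign : Sym → Sym
  | .plus => .minus
  | .minus => .plus
  | s => s

/-- Negation of a rational number in signed binary notation. -/
def negStr : List Sym → List Sym
  | s :: .slash :: r => s :: .slash :: r
  | s :: c :: r => flipSign s :: c :: r
  | l => l

/-- Pushes on `d` the negation of the rational number that is the content of `k`, bottom symbol
first. -/
def neg (k T d : K) : Prog K :=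
  move k T ;; pop T (fun
    | none => push T []
    | some s => pop T fun
      | none => push k [s] ;; push d [s]
      | some .slash => push k [s, .slash] ;; push d [s, .slash]
      | some c => push k [s, c] ;; push d [flipSign s, c]) ;; moveBoth T k d

/-- After the first move the sign is on top of `T`, followed by a digit or, if the numerator is
zero, by the slash. Hence two pops decide whether the sign is to be flipped. -/
theorem emits_neg {k T d : K} (hT : k ≠ T) (hd : k ≠ d) (hTd : T ≠ d) {S : K → List Sym}
    (hS : S T = []) : Emits (neg k T d) d S (5 * (S k).length + 6) (negStr (S k).reverse) := by
  refine Run.congr (S' := app S d (negStr (S k).reverse)) (t := (2 * (S k).length + 1) +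
    (4 + (3 * (S k).length + 1))) ?_ rfl (by omega)
  refine Run.seq (run_move hT S) ?_
  have hx : update (app S T (S k)) k [] = update (update S T (S k).reverse) k [] := by
    simp [app, hS]
  rw [hx]
  have hlen : (S k).length = (S k).reverse.length := (List.length_reverse).symm
  rw [hlen]
  have hSk : S k = (S k).reverse.reverse := (List.reverse_reverse _).symm
  generalize (S k).reverse = l at hSk
  -- Common end of all cases: `u` has been put back on `k`, `v` has been written on `d`, and the
  -- last pass distributes the remainder `r`.
  have fin : ∀ (u v r : List Sym), l = u ++ r → negStr l = v ++ r →
      Run (moveBoth T k d) (app (app (update (update S T r) k []) k u) d v) (3 * r.length + 1)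
        (app S d (negStr l)) := by
    intro u v r hu hv
    refine (run_moveBoth hT.symm hTd hd _).congr ?_ ?_
    · rw [hv]
      ext1 j
      rcases eq_or_ne j T with rfl | hj
      · simp [app, hTd, hS]
      · rcases eq_or_ne j d with rfl | hj'
        · simp [app, hj, hd.symm, hT.symm, hTd]
        · rcases eq_or_ne j k with rfl | hj''
          · simp [app, hj, hj', hj.symm, hSk, hu, hTd]
          · simp [app, hj, hj', hj'']
    · simp [app, hT.symm, hTd]
  rcases l with _ | ⟨s, _ | ⟨c, r⟩⟩
  · refine (Run.seq (.pop ?_) (fin [] [] [] rfl rfl)).congr rfl (t := 2 + 1) (by simp)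
    rw [update_of_ne hT.symm, update_self]
    refine Run.push.congr ?_ le_rfl
    ext1 j
    rcases eq_or_ne j T with rfl | hj
    · simp [app, hT.symm]
    · simp [app, hj]
  · refine (Run.seq (.pop ?_) (fin [s] [s] [] rfl rfl)).congr rfl (t := (1 + 1 + 1 + 1) + 1)
      (by simp)
    rw [update_of_ne hT.symm, update_self]
    refine .pop ?_
    rw [update_self]
    refine (Run.seq .push .push).congr ?_ le_rfl
    congr 2
    ext1 j
    rcases eq_or_ne j T with rfl | hj
    · simp [hT.symm]
    · rcases eq_or_ne j k with rfl | hj' <;> simp [*]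
  · have st : update (update (update (update S T (s :: c :: r)) k []) T (c :: r)) T r =
        update (update S T r) k [] := by
      ext1 j
      rcases eq_or_ne j T with rfl | hj
      · simp [hT.symm]
      · rcases eq_or_ne j k with rfl | hj' <;> simp [*]
    by_cases hc : c = Sym.slash
    · subst hc
      refine (Run.seq (.pop ?_) (fin [s, .slash] [s, .slash] r rfl rfl)).congr rfl
        (t := (1 + 1 + 1 + 1) + (3 * r.length + 1)) (by simp; omega)
      rw [update_of_ne hT.symm, update_self]
      refine .pop ?_
      rw [update_self]
      refine (Run.seq .push .push).congr ?_ le_rfl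
      rw [List.tail_cons, List.tail_cons, st]
    · refine (Run.seq (.pop ?_) (fin [s, c] [flipSign s, c] r rfl ?_)).congr rfl
        (t := (1 + 1 + 1 + 1) + (3 * r.length + 1)) (by simp; omega)
      · rw [update_of_ne hT.symm, update_self]
        refine .pop ?_
        rw [update_self]
        have := (Run.seq (.push (k := k) (s := [s, c])
          (S := update (update S T r) k [])) (.push (k := d) (s := [flipSign s, c])))
        rw [List.tail_cons, List.tail_cons, st]
        cases c <;> first | exact this | exact absurd rfl hc
      · cases c <;> first | rfl | exact absurd rfl hc

/-- A string to be emitted: a fixed string, the content of a stack, or the negation of the rational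
number that is the content of a stack. -/
inductive Item (K : Type)
  | const (s : List Sym)
  | copy (k : K)
  | neg (k : K)

namespace Item

/-- The string denoted by an item. -/
def str (S : K → List Sym) : Item K → List Sym
  | const s => s
  | copy k => (S k).reverse
  | neg k => negStr (S k).reverse

/-- A program that pushes an item on `d`, using the auxiliary stack `T`. -/
def prog (T d : K) : Item K → Prog K
  | const s => .push d s
  | copy k => .copy k T d
  | neg k => .neg k T d

/-- A bound for the time needed to push an item. -/
def cost (S : K → List Sym) : Item K → ℕ
  | const _ => 1
  | copy k => 5 * (S k).length + 6
  | neg k => 5 * (S k).length + 6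

/-- The stack that an item refers to has property `P`. -/
def Reads (P : K → Prop) : Item K → Prop
  | const _ => True
  | copy k => P k
  | neg k => P k

omit [DecidableEq K] in
theorem str_congr {S S' : K → List Sym} {it : Item K} (h : it.Reads fun k => S k = S' k) :
    it.str S = it.str S' := by
  cases it <;> simp_all [Reads, str]

omit [DecidableEq K] in
theorem cost_congr {S S' : K → List Sym} {it : Item K} (h : it.Reads fun k => S k = S' k) :
    it.cost S = it.cost S' := by
  cases it <;> simp_all [Reads, cost]

omit [DecidableEq K] in
theorem Reads.imp {P Q : K → Prop} (h : ∀ k, P k → Q k) {it : Item K} (hit : it.Reads P) :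
    it.Reads Q := by
  cases it <;> simp_all [Reads]

theorem emits {T d : K} (hTd : T ≠ d) {S : K → List Sym} (hS : S T = []) {it : Item K}
    (h : it.Reads fun k => k ≠ T ∧ k ≠ d) : Emits (it.prog T d) d S (it.cost S) (it.str S) := by
  cases it with
  | const s => exact emits_push ..
  | copy k => exact (emits_copy h.1 h.2 hTd hS).mono (by simp [cost])
  | neg k => exact (emits_neg h.1 h.2 hTd hS).mono (by simp [cost])

end Item

/-- Pushes a sequence of items on `d`. -/
def items (T d : K) : List (Item K) → Prog K
  | [] => push d []
  | it :: l => it.prog T d ;; items T d l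

theorem emits_items {T d : K} (hTd : T ≠ d) {S : K → List Sym} (hS : S T = []) {l : List (Item K)}
    (h : ∀ it ∈ l, it.Reads fun k => k ≠ T ∧ k ≠ d) :
    Emits (items T d l) d S ((l.map (Item.cost S)).sum + 1) (l.flatMap (Item.str S)) := by
  induction l generalizing S with
  | nil => exact emits_push ..
  | cons it l ih =>
    have hc : ∀ s, ∀ it' ∈ l, it'.Reads fun k => app S d s k = S k := fun s it' hit' =>
      (h it' (by simp [hit'])).imp fun k hk => app_of_ne hk.2 S s
    have := (Item.emits hTd hS (h it (by simp))).seq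
      (ih (S := app S d (it.str S)) (by rw [app_of_ne hTd, hS]) fun it' h' => h it' (by simp [h']))
    rw [List.map_congr_left (g := Item.cost S) fun it' h' => Item.cost_congr (hc _ it' h'),
      List.flatMap_congr fun it' h' => Item.str_congr (hc _ it' h')] at this
    refine (Emits.mono this ?_)
    simp; omega

/-- Pushes `s` on `d` as often as there are symbols on stack `c`. -/
def rep (c T d : K) (s : List Sym) : Prog K :=
  loop c (fun _ => false) (fun x => push T [x] ;; push d s) ;; move T c

/-- The counter is used up into `T` while copies of `s` are written, and is then moved back. -/
theorem emits_rep {c T d : K} (hcT : c ≠ T) (hcd : c ≠ d) (hTd : T ≠ d) {S : K → List Sym}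
    (hS : S T = []) (s : List Sym) : Emits (rep c T d s) d S (5 * (S c).length + 2)
      (List.replicate (S c).length s).flatten := by
  have h : ∀ (l : List Sym) (S : K → List Sym), S c = l →
      Run (loop c (fun _ => false) (fun x => push T [x] ;; push d s)) S (3 * l.length + 1)
        (update (app (app S T l) d (List.replicate l.length s).flatten) c []) := by
    intro l
    induction l with
    | nil => exact fun S h => (Run.loop_exit (by simp [h])).congr (by simp [h]) (by simp)
    | cons x l ih =>
      intro S h
      refine (Run.loop_step h rfl (.seq .push .push) (ih _ ?_)).congr ?_ ?_
      · simp [app, hcT, hcd]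
      · ext1 k
        rcases eq_or_ne k c with rfl | hk
        · simp
        · rcases eq_or_ne k T with rfl | hk'
          · simp [app, hk, hTd]
          · rcases eq_or_ne k d with rfl | hk''
            · simp [app, hk, hk', List.replicate_succ]
            · simp [app, hk, hk', hk'']
      · simp; omega
  refine (Run.seq (h _ S rfl) (run_move hcT.symm _)).congr ?_ ?_
  · ext1 j
    rcases eq_or_ne j T with rfl | hj
    · simp [app, hTd, hS]
    · rcases eq_or_ne j d with rfl | hj'
      · simp [app, hj, hcd.symm]
      · rcases eq_or_ne j c with rfl | hj''
        · simp [app, hj, hj', hj.symm, hS, hTd]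
        · simp [app, hj, hj', hj'']
  · simp [app, hcT.symm, hTd, hS]; omega

/-- Recognizes the comma. -/
def isComma : Sym → Bool
  | .comma => true
  | _ => false

/-- Recognizes the closing symbol of a vector or a layer. -/
def isClose : Sym → Bool
  | .close => true
  | _ => false

/-- Recognizes the final symbol of a network. -/
def isFinish : Sym → Bool
  | .finish => true
  | _ => false

/-- Reads `src` up to the first comma; copies what is read to `d`, and its image under `e`
to `d'`. -/
def readTo (src d d' : K) (e : Sym → List Sym) : Prog K :=
  loop src isComma (fun s => push d [s] ;; push d' (e s)) ;;
    push d [Sym.comma] ;; push d' (e Sym.comma)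

/-- The loop swallows the comma on which it stops, so the comma is written separately afterwards. -/
theorem run_readTo {src d d' : K} (h : src ≠ d) (h' : src ≠ d') (hd : d ≠ d') (e : Sym → List Sym)
    {u rest : List Sym} (hu : ∀ s ∈ u, s ≠ Sym.comma) {S : K → List Sym}
    (hS : S src = u ++ Sym.comma :: rest) :
    Run (readTo src d d' e) S (3 * u.length + 3) (app (app (update S src rest) d (u ++ [Sym.comma]))
      d' ((u ++ [Sym.comma]).flatMap e)) := by
  have key : Run (loop src isComma
      (fun s => push d [s] ;; push d' (e s))) S (3 * u.length + 1)
      (app (app (update S src rest) d u) d' (u.flatMap e)) := by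
    induction u generalizing S with
    | nil => exact (Run.loop_exit (by simp [hS, isComma])).congr (by simp [hS]) (by simp)
    | cons x u ih =>
      refine (Run.loop_step hS ?_ (.seq .push .push) (ih (fun s hs => hu s (by simp [hs]))
        ?_)).congr ?_ ?_
      · have := hu x (by simp)
        cases x <;> first | rfl | exact absurd rfl this
      · simp [app, h, h']
      · ext1 k
        rcases eq_or_ne k src with rfl | hk
        · simp [app, h, h']
        · rcases eq_or_ne k d with rfl | hk'
          · simp [app, hk, hd]
          · rcases eq_or_ne k d' with rfl | hk''
            · simp [app, hk, hk']
            · simp [app, hk, hk', hk'']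
      · simp; omega
  refine (Run.seq key (.seq .push .push)).congr ?_ (by omega)
  ext1 k
  rcases eq_or_ne k src with rfl | hk
  · simp [app, h, h']
  · rcases eq_or_ne k d with rfl | hk'
    · simp [app, hk, hd]
    · rcases eq_or_ne k d' with rfl | hk''
      · simp [app, hk, hk']
      · simp [app, hk, hk', hk'']

end Prog
end NeuralNet

/-! ### Writing layers with banded weight matrices. -/

namespace NeuralNet

open Function Turing

/-- The stacks of the machines below: input, output, the reversed output (`acc`) with a buffer
(`acc'`), an auxiliary stack, the reversed and the plain center, a number for biases, two unary
counters, the number that was read last, the number of nodes of the last layer, and a number for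
the biases of the comparison layer. -/
inductive Stk
  | inp | out | acc | acc' | aux | rcen | cen | rad | todo | seen | num | width | thr
  deriving DecidableEq

instance : Fintype Stk where
  elems := ⟨↑[Stk.inp, .out, .acc, .acc', .aux, .rcen, .cen, .rad, .todo, .seen, .num, .width,
    .thr], by simp⟩
  complete s := by cases s <;> simp

namespace Prog

open Stk

/-- The rows of a banded weight matrix, as strings: the blocks below, on, and above the diagonal,
together with the bias. -/
structure Row where
  bias : Item Stk
  below : List Sym
  diag : List Sym
  above : List Sym

namespace Row

/-- Pushes a neuron with activation name and comma `pre` on `acc`. -/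
def prog (pre : List Sym) (r : Row) : Prog Stk :=
  push acc pre ;; r.bias.prog aux acc ;; rep seen aux acc r.below ;; push acc r.diag ;;
    rep todo aux acc r.above ;; push acc [.close]

/-- The neuron with `i` blocks before and `j` blocks after the diagonal block. -/
def str (pre : List Sym) (S : Stk → List Sym) (i j : ℕ) (r : Row) : List Sym :=
  pre ++ (r.bias.str S ++ ((List.replicate i r.below).flatten ++ (r.diag ++
    ((List.replicate j r.above).flatten ++ [.close]))))

theorem emits {pre : List Sym} {r : Row} {S : Stk → List Sym} (hS : S aux = [])
    (hr : r.bias.Reads fun k => k ≠ aux ∧ k ≠ acc) :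
    Emits (r.prog pre) acc S (r.bias.cost S + 5 * ((S seen).length + (S todo).length) + 7)
      (r.str pre S (S seen).length (S todo).length) := by
  refine Run.congr ((emits_push acc S pre).seq <|
    (Item.emits (by decide) (by simpa [app_of_ne]) hr).seq <|
    (emits_rep (by decide) (by decide) (by decide) (by simpa [app_of_ne]) r.below).seq <|
    (emits_push ..).seq <|
    (emits_rep (by decide) (by decide) (by decide) (by simpa [app_of_ne]) r.above).seq <|
    emits_push ..) ?_ ?_
  · simp only [app_of_ne (show seen ≠ acc by decide), app_of_ne (show todo ≠ acc by decide), str]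
    rw [Item.str_congr (S' := S) (hr.imp fun k hk => app_of_ne hk.2 _ _)]
  · rw [Item.cost_congr (S' := S) (hr.imp fun k hk => app_of_ne hk.2 _ _)]
    simp only [app_of_ne (show seen ≠ acc by decide), app_of_ne (show todo ≠ acc by decide)]
    omega

end Row

/-- Pushes a sequence of neurons on `acc`. -/
def rowsProg (pre : List Sym) : List Row → Prog Stk
  | [] => push acc []
  | r :: l => r.prog pre ;; rowsProg pre l

theorem emits_rows {pre : List Sym} {l : List Row} {S : Stk → List Sym} (hS : S aux = [])
    (hl : ∀ r ∈ l, r.bias.Reads fun k => k ≠ aux ∧ k ≠ acc) {b : ℕ}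
    (hb : ∀ r ∈ l, r.bias.cost S ≤ b) :
    Emits (rowsProg pre l) acc S
      (l.length * (b + 5 * ((S seen).length + (S todo).length) + 7) + 1)
      (l.flatMap (Row.str pre S (S seen).length (S todo).length)) := by
  induction l generalizing S with
  | nil => exact (emits_push ..).mono (by simp)
  | cons r l ih =>
    have hc : ∀ s, ∀ r ∈ l, r.bias.Reads fun k => app S acc s k = S k := fun s r' h' =>
      (hl r' (by simp [h'])).imp fun k hk => app_of_ne hk.2 S s
    have := (Row.emits (pre := pre) hS (hl r (by simp))).seq
      (ih (S := app S acc (r.str pre S (S seen).length (S todo).length))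
        (by simpa [app_of_ne]) (fun r' h' => hl r' (by simp [h'])) (fun r' h' => by
          rw [Item.cost_congr (hc _ r' h')]; exact hb r' (by simp [h'])))
    simp only [app_of_ne (show seen ≠ acc by decide), app_of_ne (show todo ≠ acc by decide)] at this
    rw [List.flatMap_congr (g := Row.str pre S (S seen).length (S todo).length) fun r' h' => by
      rw [Row.str, Item.str_congr (hc _ r' h')]; rfl] at this
    refine this.mono ?_
    have := hb r (by simp)
    rw [List.length_cons, add_mul]
    omega

/-- `St i` describes the stacks after `i` rounds. The counter is popped before the body runs, hence
the shortened `todo` at the start of each round. Induction on the number of remaining rounds. -/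
theorem run_count {body : Prog Stk} (St : ℕ → Stk → List Sym) {n t : ℕ}
    (hC : ∀ i ≤ n, St i todo = List.replicate (n - i) .comma)
    (hb : ∀ i < n, Run body (update (St i) todo (List.replicate (n - (i + 1)) .comma)) t
      (St (i + 1))) :
    Run (loop todo (fun _ => false) fun _ => body) (St 0) (n * (t + 1) + 1) (St n) := by
  have key : ∀ m ≤ n, Run (loop todo (fun _ => false) fun _ => body) (St (n - m))
      (m * (t + 1) + 1) (St n) := by
    intro m
    induction m with
    | zero =>
      intro _
      have h := hC n le_rfl
      rw [Nat.sub_self] at h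
      refine (Run.loop_exit (by simp [h])).congr ?_ (by omega)
      rw [Nat.sub_zero, h]
      simpa using h
    | succ m ih =>
      intro hm
      have h := hb (n - (m + 1)) (by omega)
      rw [show n - (m + 1) + 1 = n - m by omega, show n - (n - m) = m by omega] at h
      refine (Run.loop_step (s := .comma) ?_ rfl h (ih (by omega))).mono ?_
      · rw [hC _ (by omega), show n - (n - (m + 1)) = m + 1 by omega, List.replicate_succ]
      · rw [add_mul]; omega
  simpa using key n le_rfl

/-- Pushes a layer with banded weight matrix on `acc`; the number of blocks is the number of symbols
on `todo`. -/
def band (pre : List Sym) (l : List Row) : Prog Stk :=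
  loop todo (fun _ => false) (fun _ => rowsProg pre l ;; push seen [.comma]) ;;
    push acc [.close] ;; move seen todo

/-- In round `i` there are `i` symbols on `seen` and `n - (i + 1)` on `todo`, the popped one
standing for the diagonal block. The final move refills `todo` for the next layer. -/
theorem emits_band {pre : List Sym} {l : List Row} {S : Stk → List Sym} {n b : ℕ}
    (hn : S todo = List.replicate n .comma) (hS : S aux = []) (hs : S seen = [])
    (hl : ∀ r ∈ l, r.bias.Reads fun k => k ≠ aux ∧ k ≠ acc ∧ k ≠ todo ∧ k ≠ seen)
    (hb : ∀ r ∈ l, r.bias.cost S ≤ b) :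
    Emits (band pre l) acc S (n * (l.length * (b + 5 * n + 7) + 5) + 3)
      ((List.finRange n).flatMap (fun i : Fin n => l.flatMap (Row.str pre S i (n - (i + 1)))) ++
        [.close]) := by
  rw [← List.flatMap_map Fin.val fun i => l.flatMap (Row.str pre S i (n - (i + 1))),
    List.map_coe_finRange_eq_range]
  set St : ℕ → Stk → List Sym := fun i => app (update (update S todo
    (List.replicate (n - i) .comma)) seen (List.replicate i .comma)) acc
    ((List.range i).flatMap (fun i => l.flatMap (Row.str pre S i (n - (i + 1))))) with hSt
  have hbody : ∀ i < n, Run (rowsProg pre l ;; push seen [.comma])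
      (update (St i) todo (List.replicate (n - (i + 1)) .comma))
      (l.length * (b + 5 * n + 7) + 2) (St (i + 1)) := by
    intro i hi
    set S' := update (St i) todo (List.replicate (n - (i + 1)) .comma) with hS'
    have hc : ∀ r ∈ l, r.bias.Reads fun k => S' k = S k := fun r hr =>
      (hl r hr).imp fun k hk => by simp [hS', hSt, app_of_ne, hk]
    have h := emits_rows (pre := pre) (l := l) (S := S') (b := b)
      (by simpa [hS', hSt, app_of_ne] using hS)
      (fun r hr => (hl r hr).imp fun k hk => ⟨hk.1, hk.2.1⟩)
      (fun r hr => by rw [Item.cost_congr (hc r hr)]; exact hb r hr)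
    have h1 : (S' seen).length = i := by simp [hS', hSt, app_of_ne]
    have h2 : (S' todo).length = n - (i + 1) := by simp [hS']
    rw [h1, h2, List.flatMap_congr (g := Row.str pre S i (n - (i + 1))) fun r' h' => by
      rw [Row.str, Item.str_congr (hc r' h')]; rfl] at h
    refine (Run.seq h .push).congr ?_ ?_
    · ext1 k
      cases k <;> simp [hS', hSt, app, List.range_succ, List.replicate_succ]
    · have : l.length * (b + 5 * (i + (n - (i + 1))) + 7) ≤ l.length * (b + 5 * n + 7) :=
        Nat.mul_le_mul_left _ (by omega)
      omega
  have h0 : St 0 = S := by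
    ext1 k
    cases k <;> simp [hSt, hn, hs]
  have h := run_count St (fun i _ => by simp [hSt, app_of_ne]) hbody
  rw [h0] at h
  refine (Run.seq h (.seq .push (run_move (by decide) _))).congr ?_ ?_
  · ext1 k
    cases k <;> simp [hSt, app, hn, hs]
  · simp [hSt, app_of_ne, mul_add]
    omega

/-- Pushes a layer with banded weight matrix on `acc`; the number of blocks is the number of symbols
on `todo`, and the rational numbers on `cen` are available for the biases of the blocks. -/
def bandRead (pre : List Sym) (l : List Row) : Prog Stk :=
  loop todo (fun _ => false) (fun _ => readTo cen num acc (fun _ => []) ;; rowsProg pre l ;;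
    clear num ;; push seen [.comma]) ;; push acc [.close] ;; move seen todo

/-- The comma occurs only as terminator, so reading up to the first comma reads one rational number.
-/
theorem encRat_eq (q : ℚ) : ∃ u, (∀ s ∈ u, s ≠ Sym.comma) ∧ encRat q = u ++ [.comma] := by
  refine ⟨_, ?_, rfl⟩
  intro s hs
  simp only [encNat, List.mem_append, List.mem_cons, List.mem_map] at hs
  split_ifs at hs
  all_goals
    rcases hs with (rfl | ⟨_, _, rfl⟩) | (rfl | ⟨_, _, rfl⟩) <;> simp

theorem run_readRat {src d d' : Stk} (h : src ≠ d) (h' : src ≠ d') (hd : d ≠ d')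
    (e : Sym → List Sym) {q : ℚ} {rest : List Sym} {S : Stk → List Sym}
    (hS : S src = encRat q ++ rest) :
    Run (readTo src d d' e) S (3 * (encRat q).length) (app (app (update S src rest) d (encRat q))
      d' ((encRat q).flatMap e)) := by
  obtain ⟨u, hu, he⟩ := encRat_eq q
  rw [he] at hS ⊢
  exact (run_readTo h h' hd e hu (by simpa using hS)).mono (by simp; omega)

/-- As for `emits_band`, but each round first loads one entry of the center into `num`, so that the
bias can vary with the block. The center is used up. -/
theorem run_bandRead {pre : List Sym} {l : List Row} {S : Stk → List Sym} {n b : ℕ}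
    {x : Fin n → ℚ} (hn : S todo = List.replicate n .comma) (hS : S aux = []) (hs : S seen = [])
    (hnum : S num = []) (hcen : S cen = (List.ofFn x).flatMap encRat)
    (hl : ∀ r ∈ l, r.bias.Reads fun k => k ≠ aux ∧ k ≠ acc ∧ k ≠ todo ∧ k ≠ seen ∧ k ≠ cen)
    (hb : ∀ r ∈ l, ∀ i, r.bias.cost (update S num (encRat (x i)).reverse) ≤ b)
    (hx : ∀ i, (encRat (x i)).length ≤ b) :
    Run (bandRead pre l) S (n * (l.length * (b + 5 * n + 7) + 5 * b + 6) + 3)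
      (app (update S cen []) acc (((List.finRange n).flatMap (fun i => l.flatMap
        (Row.str pre (update S num (encRat (x i)).reverse) i (n - (i + 1))))) ++ [.close])) := by
  set g : Fin n → List Sym := fun i => l.flatMap
    (Row.str pre (update S num (encRat (x i)).reverse) i (n - (i + 1))) with hg
  -- Extension of `g` to all natural numbers, since the loop invariant is indexed by `ℕ`; the
  -- default is never used below `n`.
  set out : ℕ → List Sym := fun i => if h : i < n then g ⟨i, h⟩ else [] with hout
  set St : ℕ → Stk → List Sym := fun i => app (update (update (update S todo
    (List.replicate (n - i) .comma)) seen (List.replicate i .comma)) cen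
    (((List.ofFn x).drop i).flatMap encRat)) acc ((List.range i).flatMap out) with hSt
  have hbody : ∀ i < n, Run (readTo cen num acc (fun _ => []) ;; rowsProg pre l ;;
      clear num ;; push seen [.comma])
      (update (St i) todo (List.replicate (n - (i + 1)) .comma))
      (l.length * (b + 5 * n + 7) + 5 * b + 3) (St (i + 1)) := by
    intro i hi
    have ho : out i = g ⟨i, hi⟩ := by simp [hout, hi]
    have hdrop : (List.ofFn x).drop i = x ⟨i, hi⟩ :: (List.ofFn x).drop (i + 1) := by
      rw [List.drop_eq_getElem_cons (by simpa using hi)]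
      simp
    have hr := run_readRat (src := cen) (d := num) (d' := acc) (by decide) (by decide) (by decide)
      (fun _ => []) (q := x ⟨i, hi⟩) (rest := ((List.ofFn x).drop (i + 1)).flatMap encRat)
      (S := update (St i) todo (List.replicate (n - (i + 1)) .comma))
      (by simp [hSt, app_of_ne, hdrop])
    rw [show (encRat (x ⟨i, hi⟩)).flatMap (fun _ => ([] : List Sym)) = [] by simp, app_nil] at hr
    set S' := app (update (update (St i) todo (List.replicate (n - (i + 1)) .comma)) cen
      (((List.ofFn x).drop (i + 1)).flatMap encRat)) num (encRat (x ⟨i, hi⟩)) with hS'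
    have hc : ∀ r ∈ l, r.bias.Reads fun k => S' k = update S num (encRat (x ⟨i, hi⟩)).reverse k :=
      fun r hr => (hl r hr).imp fun k hk => by
        rcases eq_or_ne k num with rfl | hk'
        · simp [hS', hSt, app, hnum]
        · simp [hS', hSt, app_of_ne, hk, hk']
    have h := emits_rows (pre := pre) (l := l) (S := S') (b := b)
      (by simpa [hS', hSt, app_of_ne] using hS)
      (fun r hr => (hl r hr).imp fun k hk => ⟨hk.1, hk.2.1⟩)
      (fun r hr => by rw [Item.cost_congr (hc r hr)]; exact hb r hr _)
    have h1 : (S' seen).length = i := by simp [hS', hSt, app_of_ne]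
    have h2 : (S' todo).length = n - (i + 1) := by simp [hS', app_of_ne]
    rw [h1, h2, List.flatMap_congr (g := Row.str pre (update S num (encRat (x ⟨i, hi⟩)).reverse) i
      (n - (i + 1))) fun r' h' => by rw [Row.str, Item.str_congr (hc r' h')]; rfl] at h
    change Emits _ _ _ _ (g ⟨i, hi⟩) at h
    refine (Run.seq hr (.seq h (.seq (run_clear _ _) .push))).congr ?_ ?_
    · clear_value out g
      ext1 k
      cases k <;> simp [hS', hSt, app, List.range_succ, List.replicate_succ, hnum, ho]
    · have : l.length * (b + 5 * (i + (n - (i + 1))) + 7) ≤ l.length * (b + 5 * n + 7) :=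
        Nat.mul_le_mul_left _ (by omega)
      have := hx ⟨i, hi⟩
      simp [hS', hSt, app, hnum]
      omega
  have h0 : St 0 = S := by
    ext1 k
    cases k <;> simp [hSt, hn, hs, hcen]
  have h := run_count St (fun i _ => by simp [hSt, app_of_ne]) hbody
  rw [h0] at h
  have hfin : (List.range n).flatMap out = (List.finRange n).flatMap g := by
    rw [← List.map_coe_finRange_eq_range, List.flatMap_map]
    refine List.flatMap_congr fun i _ => ?_
    simp [hout]
  rw [← hfin]
  clear_value out
  have hdrop : (List.ofFn x).drop n = [] := List.drop_eq_nil_of_le (by simp)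
  refine (Run.seq h (.seq .push (run_move (by decide) _))).congr ?_ ?_
  · ext1 k
    cases k <;> simp [hSt, app, hn, hs, hdrop]
  · simp [hSt, app_of_ne, mul_add]
    omega

end Prog
end NeuralNet

/-! ### Rewriting the given network: signed multiples of weights, duplicated nodes. -/

namespace NeuralNet

open Function Turing

namespace Prog

open Stk

theorem encRat_ne (q : ℚ) : ∃ s l, encRat q = s :: l ∧ isClose s = false := by
  simp only [encRat]
  split_ifs
  · exact ⟨_, _, rfl, rfl⟩
  · exact ⟨_, _, rfl, rfl⟩

theorem length_encRat_pos (q : ℚ) : 1 ≤ (encRat q).length := by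
  simp [encRat]

theorem encRat_zero : encRat 0 = [.plus, .slash, .bit true, .comma] := by
  simp [encRat, encNat]

/-- Zero has no digits in its numerator, so its second symbol is the slash and `negStr` leaves it
alone. Otherwise the second symbol is a digit, and negation changes only the sign. -/
theorem encRat_neg (q : ℚ) : encRat (-q) = negStr (encRat q) := by
  rcases eq_or_ne q 0 with rfl | hq
  · simp [encRat_zero, negStr]
  · have hb : q.num.natAbs.bits ≠ [] := by
      intro h
      have h' := congrArg List.length h
      rw [Nat.size_eq_bits_len, List.length_nil, Nat.size_eq_zero] at h'
      exact hq (Rat.num_eq_zero.mp (Int.natAbs_eq_zero.mp h'))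
    obtain ⟨d, l, hd⟩ := List.exists_cons_of_ne_nil hb
    rcases lt_or_gt_of_ne hq with h | h
    · simp [encRat, encNat, hd, h, h.le.not_gt, negStr, flipSign]
    · simp [encRat, encNat, hd, h, h.le.not_gt, negStr, flipSign]

theorem length_negStr (l : List Sym) : (negStr l).length = l.length := by
  rcases l with _ | ⟨s, _ | ⟨c, r⟩⟩
  · rfl
  · rfl
  · cases c <;> rfl

/-- The product of a sign and the rational number on `num`. -/
def signItem : SignType → Item Stk
  | .pos => .copy num
  | .neg => .neg num
  | .zero => .const (encRat 0)

/-- The products of a rational number with a sequence of signs. -/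
def multStr (σ : List SignType) (w : ℚ) : List Sym :=
  σ.flatMap fun s : SignType => encRat ((s : ℚ) * w)

theorem str_signItem {S : Stk → List Sym} {w : ℚ} (h : S num = (encRat w).reverse) (s : SignType) :
    (signItem s).str S = encRat ((s : ℚ) * w) := by
  cases s <;> simp [signItem, Item.str, h, encRat_neg]

/-- The factor `4` is the length of the code of zero, which a sign `0` substitutes for the code of
`w`. -/
theorem length_multStr (σ : List SignType) (w : ℚ) :
    (multStr σ w).length ≤ σ.length * (4 * (encRat w).length) := by
  have := length_encRat_pos w
  induction σ with
  | nil => simp [multStr]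
  | cons s σ ih =>
    have h : (encRat ((s : ℚ) * w)).length ≤ 4 * (encRat w).length := by
      cases s
      · simp [encRat_zero]; omega
      · simp [encRat_neg, length_negStr]; omega
      · simp; omega
    simp only [multStr, List.flatMap_cons, List.length_append, List.length_cons, add_mul] at ih ⊢
    omega

/-- Reads a rational number from `inp`, and pushes its products with `σ` on `acc` and those with
`σ'` on `acc'`. -/
def weightProg (σ σ' : List SignType) (s : Sym) : Prog Stk :=
  push inp [s] ;; readTo inp num acc (fun _ => []) ;; items aux acc (σ.map signItem) ;;
    items aux acc' (σ'.map signItem) ;; clear num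

theorem reads_signItem {P : Stk → Prop} (h : P num) (s : SignType) : (signItem s).Reads P := by
  cases s <;> simp [signItem, Item.Reads, h]

theorem emits_signs {d : Stk} (hd : aux ≠ d) (hd' : num ≠ d) {S : Stk → List Sym} {w : ℚ}
    (hS : S aux = []) (hw : S num = (encRat w).reverse) {σ : List SignType}
    (hσ : σ.length ≤ 4) :
    Emits (items aux d (σ.map signItem)) d S (20 * (encRat w).length + 25) (multStr σ w) := by
  have h := emits_items hd hS (l := σ.map signItem) (by
    intro it hit
    obtain ⟨s, _, rfl⟩ := List.mem_map.mp hit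
    exact reads_signItem ⟨by decide, hd'⟩ s)
  rw [List.flatMap_map, List.flatMap_congr fun s _ => str_signItem hw s] at h
  refine h.mono ?_
  have : ((σ.map signItem).map (Item.cost S)).sum ≤
      σ.length * (5 * (encRat w).length + 6) := by
    rw [List.map_map]
    refine (List.sum_le_card_nsmul _ (5 * (encRat w).length + 6) ?_).trans (by simp)
    intro c hc
    obtain ⟨s, _, rfl⟩ := List.mem_map.mp hc
    cases s <;> simp [signItem, Item.cost, hw]
  have := Nat.mul_le_mul_right (5 * (encRat w).length + 6) hσ
  omega

/-- The loop test pops the first symbol of a weight, and the body puts it back; this symbol is never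
the closing one. Each weight is loaded into `num` once and written in all required multiples. -/
theorem run_weights {σ σ' : List SignType} (hσ : σ.length ≤ 4) (hσ' : σ'.length ≤ 4)
    {ws : List ℚ} {rest : List Sym} {S : Stk → List Sym} (hS : S aux = []) (hnum : S num = [])
    (hin : S inp = ws.flatMap encRat ++ .close :: rest) :
    Run (loop inp isClose (weightProg σ σ')) S (100 * (ws.flatMap encRat).length + 1)
      (app (app (update S inp rest) acc (ws.flatMap (multStr σ))) acc'
        (ws.flatMap (multStr σ'))) := by
  induction ws generalizing S with
  | nil => exact (Run.loop_exit (by simp [hin, isClose])).congr (by simp [hin]) (by simp)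
  | cons w ws ih =>
    obtain ⟨s, l, hw, hs⟩ := encRat_ne w
    rw [List.flatMap_cons, hw, List.append_assoc, List.cons_append] at hin
    set l' := l ++ (ws.flatMap encRat ++ .close :: rest)
    set r := ws.flatMap encRat ++ .close :: rest with hr
    have h0 : Run (push inp [s]) (update S inp l') 1 S := by
      refine Run.push.congr ?_ le_rfl
      ext1 k
      cases k <;> simp [app, hin]
    have h1 := run_readRat (src := inp) (d := num) (d' := acc) (by decide) (by decide)
      (by decide) (fun _ => []) (S := S) (q := w) (rest := r) (by simp [hin, hw, l', r])
    rw [show (encRat w).flatMap (fun _ => ([] : List Sym)) = [] by simp, app_nil] at h1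
    have h2 := emits_signs (d := acc) (by decide) (by decide)
      (S := app (update S inp r) num (encRat w)) (w := w)
      (by simpa [app]) (by simp [app, hnum]) hσ
    have h3 := emits_signs (d := acc') (by decide) (by decide)
      (S := app (app (update S inp r) num (encRat w)) acc (multStr σ w)) (w := w)
      (by simpa [app]) (by simp [app, hnum]) hσ'
    refine (Run.loop_step hin hs (.seq h0 <| .seq h1 <| .seq h2 <| .seq h3 <| run_clear _ _)
      (ih ?_ ?_ ?_)).congr ?_ ?_
    · simp [app, hS]
    · simp
    · simp [app, r]
    · ext1 k
      cases k <;> simp [app, hnum]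
    · have := length_encRat_pos w
      simp [app, hnum]
      omega

section Net

variable {A : Type} (name : A → List Bool)

/-- The code of a neuron whose weights are multiplied by the signs `σ`. -/
def neuronStr (σ : List SignType) {n : ℕ} (u : Neuron A n) : List Sym :=
  (name u.act).map Sym.bit ++ Sym.comma :: encRat u.bias ++
    ((List.ofFn u.weight).flatMap (multStr σ) ++ [.close])

/-- The code of a neuron with weights multiplied by the signs `σ`, followed by the code of the
neuron with weights multiplied by the signs `σ'`, if any. -/
def neuronsStr (σ : List SignType) (σ' : Option (List SignType)) {n : ℕ} (u : Neuron A n) :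
    List Sym :=
  neuronStr name σ u ++ σ'.elim [] fun σ' => neuronStr name σ' u

/-- The identity if there is a second sign sequence. -/
def echo (σ' : Option (List SignType)) (s : Sym) : List Sym := if σ'.isSome then [s] else []

/-- Reads a neuron from `inp`, and pushes it on `acc` with modified weights. -/
def neuronProg (σ : List SignType) (σ' : Option (List SignType)) : Prog Stk :=
  readTo inp acc acc' (echo σ') ;; readTo inp acc acc' (echo σ') ;;
    loop inp isClose (weightProg σ (σ'.getD [])) ;; push acc [.close] ;;
    push acc' (echo σ' .close) ;; move acc' aux ;; move aux acc ;; push width [.comma]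

theorem flatMap_echo (σ' : Option (List SignType)) (l : List Sym) :
    l.flatMap (echo σ') = if σ'.isSome then l else [] := by
  unfold echo
  split_ifs <;> simp

theorem length_flatMap_multStr {σ : List SignType} (hσ : σ.length ≤ 4) (ws : List ℚ) :
    (ws.flatMap (multStr σ)).length ≤ 16 * (ws.flatMap encRat).length := by
  induction ws with
  | nil => simp
  | cons w ws ih =>
    have := length_multStr σ w
    have := Nat.mul_le_mul_right (4 * (encRat w).length) hσ
    simp only [List.flatMap_cons, List.length_append]
    omega

/-- A single pass yields both variants: the first goes straight to `acc`, the second is gathered in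
`acc'` and appended by two moves, whose reversals cancel. Without a second sign sequence `acc'`
stays empty. `width` counts original neurons, not variants. -/
theorem run_neuron {σ : List SignType} {σ' : Option (List SignType)} (hσ : σ.length ≤ 4)
    (hσ' : ∀ τ ∈ σ', τ.length ≤ 4) {n : ℕ} (u : Neuron A n) {rest : List Sym}
    {S : Stk → List Sym} (hS : S aux = []) (hnum : S num = []) (hacc : S acc' = [])
    (hin : S inp = encNeuron name u ++ rest) :
    Run (neuronProg σ σ') S (200 * (encNeuron name u).length)
      (app (app (update S inp rest) acc (neuronsStr name σ σ' u)) width [.comma]) := by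
  have h1 := run_readTo (src := inp) (d := acc) (d' := acc') (by decide) (by decide) (by decide)
    (echo σ') (u := (name u.act).map Sym.bit) (rest := encRat u.bias ++ (encVec u.weight ++ rest))
    (fun s hs => by obtain ⟨b, _, rfl⟩ := List.mem_map.mp hs; simp) (S := S) (by simp [hin, encNeuron])
  have h2 := run_readRat (src := inp) (d := acc) (d' := acc') (by decide) (by decide) (by decide)
    (echo σ') (q := u.bias) (rest := encVec u.weight ++ rest)
    (S := app (app (update S inp (encRat u.bias ++ (encVec u.weight ++ rest))) acc
      ((name u.act).map Sym.bit ++ [Sym.comma])) acc'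
      (((name u.act).map Sym.bit ++ [Sym.comma]).flatMap (echo σ'))) (by simp [app])
  have h3 := run_weights (ws := List.ofFn u.weight) (rest := rest) hσ (σ' := σ'.getD [])
    (by cases σ' <;> simp_all) (S := app (app (update (app (app (update S inp
      (encRat u.bias ++ (encVec u.weight ++ rest))) acc
      ((name u.act).map Sym.bit ++ [Sym.comma])) acc'
      (((name u.act).map Sym.bit ++ [Sym.comma]).flatMap (echo σ'))) inp
      (encVec u.weight ++ rest)) acc (encRat u.bias)) acc' ((encRat u.bias).flatMap (echo σ')))
    (by simpa [app]) (by simpa [app]) (by simp [app, encVec])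
  refine (Run.seq h1 <| .seq h2 <| .seq h3 <| .seq .push <| .seq .push <|
    .seq (run_move (by decide) _) <| .seq (run_move (by decide) _) .push).congr ?_ ?_
  · simp only [flatMap_echo]
    ext1 k
    rcases σ' with _ | τ
    · cases k <;> simp [app, hS, hacc, echo, neuronsStr, neuronStr, multStr]
    · cases k <;> simp [app, hS, hacc, echo, neuronsStr, neuronStr]
  · have hl : (encNeuron name u).length = (name u.act).length + 1 + (encRat u.bias).length +
        ((List.ofFn u.weight).flatMap encRat).length + 1 := by
      simp [encNeuron, encVec]; omega
    have h4 : ((List.ofFn u.weight).flatMap (multStr (σ'.getD []))).length ≤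
        16 * ((List.ofFn u.weight).flatMap encRat).length :=
      length_flatMap_multStr (by cases σ' <;> simp_all) _
    simp only [flatMap_echo]
    have h5 : ∀ l, (if σ'.isSome then l else ([] : List Sym)).length ≤ l.length := by
      intro l; split_ifs <;> simp
    have h6 := h5 ((name u.act).map Sym.bit ++ [Sym.comma])
    have h7 := h5 (encRat u.bias)
    have h8 := h5 [Sym.close]
    simp only [List.length_append, List.length_map, List.length_cons, List.length_nil] at h6 h8
    rw [hl]
    simp [app, hS, hacc, echo, -List.length_flatMap]
    omega

/-- Reads a layer from `inp`, and pushes it on `acc` with modified weights. -/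
def layerProg (σ : List SignType) (σ' : Option (List SignType)) : Prog Stk :=
  loop inp isClose (fun s => push inp [s] ;; neuronProg σ σ') ;; push acc [.close]

theorem encNeuron_ne {n : ℕ} (u : Neuron A n) :
    ∃ s l, encNeuron name u = s :: l ∧ isClose s = false ∧ isFinish s = false := by
  simp only [encNeuron]
  rcases name u.act with _ | ⟨b, l⟩
  · exact ⟨_, _, rfl, rfl, rfl⟩
  · exact ⟨_, _, rfl, rfl, rfl⟩

theorem replicate_append_cons {α : Type} (n : ℕ) (a : α) (l : List α) :
    List.replicate n a ++ a :: l = a :: (List.replicate n a ++ l) := by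
  rw [← List.cons_append, ← List.replicate_succ, List.replicate_succ', List.append_assoc,
    List.singleton_append]

theorem run_neurons {σ : List SignType} {σ' : Option (List SignType)} (hσ : σ.length ≤ 4)
    (hσ' : ∀ τ ∈ σ', τ.length ≤ 4) {n : ℕ} {us : List (Neuron A n)} {rest : List Sym}
    {S : Stk → List Sym} (hS : S aux = []) (hnum : S num = []) (hacc : S acc' = [])
    (hin : S inp = us.flatMap (encNeuron name) ++ .close :: rest) :
    Run (loop inp isClose (fun s => push inp [s] ;; neuronProg σ σ')) S
      (202 * (us.flatMap (encNeuron name)).length + 1)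
      (app (app (update S inp rest) acc (us.flatMap (neuronsStr name σ σ'))) width
        (List.replicate us.length .comma)) := by
  induction us generalizing S with
  | nil => exact (Run.loop_exit (by simp [hin, isClose])).congr (by simp [hin]) (by simp)
  | cons u us ih =>
    obtain ⟨s, l, hw, hs, _⟩ := encNeuron_ne name u
    rw [List.flatMap_cons, hw, List.append_assoc, List.cons_append] at hin
    set l' := l ++ (us.flatMap (encNeuron name) ++ .close :: rest)
    have h0 : Run (push inp [s]) (update S inp l') 1 S := by
      refine Run.push.congr ?_ le_rfl
      ext1 k
      cases k <;> simp [app, hin]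
    have h1 := run_neuron name hσ hσ' u hS hnum hacc
      (rest := us.flatMap (encNeuron name) ++ .close :: rest) (by simp [hin, hw, l'])
    refine (Run.loop_step hin hs (.seq h0 h1) (ih ?_ ?_ ?_ ?_)).congr ?_ ?_
    · simp [app, hS]
    · simp [app, hnum]
    · simp [app, hacc]
    · simp [app]
    · ext1 k
      cases k <;> simp [app, List.replicate_succ, replicate_append_cons]
    · have := congrArg List.length hw
      simp only [List.length_cons, List.flatMap_cons, List.length_append] at this ⊢
      omega

/-- The code of a layer with modified weights. -/
def layerStr (σ : List SignType) (σ' : Option (List SignType)) {n k : ℕ}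
    (layer : Fin k → Neuron A n) : List Sym :=
  (List.ofFn layer).flatMap (neuronsStr name σ σ') ++ [.close]

theorem run_layer {σ : List SignType} {σ' : Option (List SignType)} (hσ : σ.length ≤ 4)
    (hσ' : ∀ τ ∈ σ', τ.length ≤ 4) {n k : ℕ} {layer : Fin k → Neuron A n} {rest : List Sym}
    {S : Stk → List Sym} (hS : S aux = []) (hnum : S num = []) (hacc : S acc' = [])
    (hin : S inp = encLayer name layer ++ rest) :
    Run (layerProg σ σ') S (202 * (encLayer name layer).length)
      (app (app (update S inp rest) acc (layerStr name σ σ' layer)) width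
        (List.replicate k .comma)) := by
  refine (Run.seq (run_neurons name hσ hσ' hS hnum hacc (us := List.ofFn layer) (rest := rest)
    (by simp [hin, encLayer])) .push).congr ?_ ?_
  · ext1 k
    cases k <;> simp [app, layerStr]
  · simp [encLayer]; omega

/-- The code of a network in which every node is duplicated. -/
def doubledStr : {n m : ℕ} → Net A n m → List Sym
  | _, _, .output layer => layerStr name [1, 0] (some [0, 1]) layer
  | _, _, .hidden layer rest => layerStr name [1, 0] (some [0, 1]) layer ++ doubledStr rest

/-- Reads a network from `inp`, and pushes it on `acc` with duplicated nodes. -/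
def doubleProg : Prog Stk :=
  loop inp isFinish fun s => push inp [s] ;; clear width ;; layerProg [1, 0] (some [0, 1])

theorem encLayer_ne {n k : ℕ} (layer : Fin k → Neuron A n) :
    ∃ s l, encLayer name layer = s :: l ∧ isFinish s = false := by
  simp only [encLayer]
  rcases List.ofFn layer with _ | ⟨u, l⟩
  · exact ⟨_, _, rfl, rfl⟩
  · obtain ⟨s, l', h, _, h'⟩ := encNeuron_ne name u
    exact ⟨s, _, by rw [List.flatMap_cons, h]; rfl, h'⟩

theorem length_lt_encLayer {n k : ℕ} (layer : Fin k → Neuron A n) :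
    k < (encLayer name layer).length := by
  have : ∀ us : List (Neuron A n), us.length ≤ (us.flatMap (encNeuron name)).length := by
    intro us
    induction us with
    | nil => simp
    | cons u us ih =>
      obtain ⟨s, l, h, _⟩ := encNeuron_ne name u
      simp only [List.flatMap_cons, h, List.length_append, List.length_cons]
      omega
  simpa [encLayer, Nat.lt_succ_iff] using this (List.ofFn layer)

/-- One round of the loop. Clearing `width` first ensures that in the end it counts the nodes of the
last layer only. -/
theorem run_double_step {n k : ℕ} {layer : Fin k → Neuron A n} {r : List Sym}
    {S S' : Stk → List Sym} {t : ℕ} (hS : S aux = []) (hnum : S num = []) (hacc : S acc' = [])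
    (hin : S inp = encLayer name layer ++ r)
    (h : Run doubleProg (app (update (update S inp r) width (List.replicate k .comma)) acc
      (layerStr name [1, 0] (some [0, 1]) layer)) t S') :
    Run doubleProg S (202 * (encLayer name layer).length + 2 * (S width).length + t + 3) S' := by
  obtain ⟨s, l, hl, hs⟩ := encLayer_ne name layer
  have h0 : Run (push inp [s]) (update S inp (l ++ r)) 1 S := by
    refine Run.push.congr ?_ le_rfl
    ext1 k
    cases k <;> simp [app, hin, hl]
  have h1 := run_layer name (σ := [1, 0]) (σ' := some [0, 1]) (by simp) (by simp)
    (layer := layer) (rest := r) (S := update S width []) (by simpa) (by simpa) (by simpa)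
    (by simpa)
  refine (Run.loop_step (by rw [hin, hl]; rfl) hs (.seq h0 (.seq (run_clear _ _) h1))
    (S'' := S') (t' := t) ?_).mono ?_
  · refine Eq.subst (motive := fun S₀ => Run doubleProg S₀ t S') ?_ h
    ext1 k
    cases k <;> simp [app]
  · omega

/-- The term with `S width` pays for clearing the count left by the previous layer; inside the
network this count is smaller than the code of the layer just read, which absorbs the cost. -/
theorem run_double {n m : ℕ} (N : Net A n m) {rest : List Sym} {S : Stk → List Sym}
    (hS : S aux = []) (hnum : S num = []) (hacc : S acc' = [])
    (hin : S inp = encNet name N ++ rest) :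
    Run doubleProg S (210 * (encNet name N).length + 2 * (S width).length)
      (app (update (update S inp rest) width (List.replicate m .comma)) acc
        (doubledStr name N)) := by
  induction N generalizing S with
  | output layer =>
    rw [encNet, List.append_assoc] at hin
    refine (run_double_step name hS hnum hacc hin (t := 1)
      (Run.loop_exit (by simp [app, isFinish]))).congr ?_ ?_
    · ext1 k
      cases k <;> simp [app, doubledStr]
    · simp [encNet]; omega
  | @hidden n k m layer N ih =>
    rw [encNet, List.append_assoc] at hin
    refine (run_double_step name hS hnum hacc hin
      (ih (by simpa [app]) (by simpa [app]) (by simpa [app]) (by simp [app]))).congr ?_ ?_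
    · ext1 k
      cases k <;> simp [app, doubledStr]
    · have h1 := length_lt_encLayer name layer
      simp [encNet, app]
      omega

end Net

end Prog
end NeuralNet

/-! ### Block structured networks, the reduced instances and their encodings. -/

namespace NeuralNet

open Function Turing

section Blocks

/-- The vector with `n` blocks of size `b` whose entries are given by `g`. -/
def blk {α : Type} {n b : ℕ} (g : Fin n → Fin b → α) : Fin (n * b) → α :=
  fun i => g i.divNat i.modNat

@[simp]
theorem blk_apply {α : Type} {n b : ℕ} (g : Fin n → Fin b → α) (i : Fin n) (j : Fin b) :
    blk g (finProdFinEquiv (i, j)) = g i j := by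
  have h := finProdFinEquiv.symm_apply_apply (i, j)
  rw [finProdFinEquiv_symm_apply, Prod.mk.injEq] at h
  rw [blk, h.1, h.2]

theorem forall_blk {n b : ℕ} {P : Fin (n * b) → Prop} :
    (∀ i, P i) ↔ ∀ i j, P (finProdFinEquiv (i, j)) :=
  ⟨fun h _ _ => h _, fun h i => by
    rw [← finProdFinEquiv.apply_symm_apply i]; exact h _ _⟩

theorem sum_blk {n b : ℕ} (f : Fin (n * b) → ℝ) :
    ∑ i, f i = ∑ i, ∑ j, f (finProdFinEquiv (i, j)) := by
  rw [← finProdFinEquiv.sum_comp, Fintype.sum_prod_type]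

theorem ofFn_blk {α : Type} {n b : ℕ} (g : Fin n → Fin b → α) :
    List.ofFn (blk g) = (List.finRange n).flatMap fun i => List.ofFn (g i) := by
  rw [List.ofFn_mul, List.flatMap, List.ofFn_eq_map]
  congr 1
  refine List.map_congr_left fun i _ => congrArg List.ofFn (funext fun j => ?_)
  have := blk_apply g i j
  rw [← this]
  congr 1
  ext
  simp [finProdFinEquiv, add_comm, mul_comm]

/-- Brings a row of a banded matrix into the form that is written with the help of two unary
counters. -/
theorem flatMap_finRange_ite {α : Type} {n : ℕ} (k : Fin n) (a b c : List α) :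
    (List.finRange n).flatMap (fun i => if i < k then a else if i = k then b else c) =
      (List.replicate k a).flatten ++ (b ++ (List.replicate (n - (k + 1)) c).flatten) := by
  have h : (List.finRange n).map (fun i => if i < k then a else if i = k then b else c) =
      List.replicate k a ++ (b :: List.replicate (n - (k + 1)) c) := by
    refine List.ext_getElem (by simp; omega) fun i h₁ h₂ => ?_
    simp only [List.getElem_map, List.getElem_finRange, Fin.lt_def, Fin.ext_iff, Fin.val_cast]
    rcases lt_trichotomy i k with h | h | h
    · simp [h]
    · simp [h]
    · rw [if_neg (by omega), if_neg (by omega), List.getElem_append_right (by simp; omega),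
        List.getElem_cons, dif_neg (by simp; omega), List.getElem_replicate]
  rw [List.flatMap, h]
  simp

end Blocks

variable {A : Type} (name : A → List Bool)

/-- The blocks below and on the diagonal of a block triangular matrix. -/
structure Band (r c : ℕ) where
  below : Fin r → Fin c → ℚ
  diag : Fin r → Fin c → ℚ

/-- The layer with a banded, lower block triangular weight matrix. -/
def bandLayer {n r c : ℕ} (σ : A) (B : Band r c) (bias : Fin n → Fin r → ℚ) :
    Fin (n * r) → Neuron A (n * c) :=
  blk fun k ρ => ⟨σ, bias k ρ, blk fun k' γ =>
    if k' < k then B.below ρ γ else if k' = k then B.diag ρ γ else 0⟩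

/-- The rational numbers of a vector, without the closing symbol. -/
def encs {c : ℕ} (v : Fin c → ℚ) : List Sym := (List.ofFn v).flatMap encRat

open Prog Stk

/-- The rows of a band. -/
def Band.rows {r c : ℕ} (B : Band r c) (it : Fin r → Item Stk) : List Row :=
  List.ofFn fun ρ => ⟨it ρ, encs (B.below ρ), encs (B.diag ρ), encs fun _ : Fin c => 0⟩

/-- The name of an activation, with the separator. -/
def actStr (σ : A) : List Sym := (name σ).map Sym.bit ++ [Sym.comma]

/-- `S k` stands for the stacks at the time block `k` is written, from which the items `it` take the
biases. The right-hand side is what the programs `band` and `bandRead` produce. -/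
theorem encLayer_bandLayer {n r c : ℕ} (σ : A) (B : Band r c) (bias : Fin n → Fin r → ℚ)
    (it : Fin r → Item Stk) (S : Fin n → Stk → List Sym)
    (h : ∀ k ρ, (it ρ).str (S k) = encRat (bias k ρ)) :
    encLayer name (bandLayer σ B bias) = ((List.finRange n).flatMap fun k : Fin n =>
      (B.rows it).flatMap (Row.str (actStr name σ) (S k) k (n - (k + 1)))) ++ [.close] := by
  rw [encLayer, bandLayer, ofFn_blk, List.flatMap_assoc]
  congr 1
  refine List.flatMap_congr fun k _ => ?_
  rw [Band.rows, List.ofFn_eq_map, List.ofFn_eq_map, List.flatMap_map, List.flatMap_map]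
  refine List.flatMap_congr fun ρ _ => ?_
  rw [Row.str, h]
  simp only [encNeuron, actStr, encVec, ofFn_blk, List.flatMap_assoc]
  have : ((List.finRange n).flatMap fun k' => (List.ofFn fun γ => if k' < k then B.below ρ γ else
      if k' = k then B.diag ρ γ else 0).flatMap encRat) =
      (List.finRange n).flatMap fun k' => if k' < k then encs (B.below ρ) else
        if k' = k then encs (B.diag ρ) else encs fun _ : Fin c => 0 := by
    refine List.flatMap_congr fun k' _ => ?_
    split_ifs <;> rfl
  rw [this, flatMap_finRange_ite]
  simp

/-- The neuron whose inputs are blocks of size `c`, which are summed up with signs `σ`. -/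
def Neuron.expand {n c : ℕ} (σ : Fin c → SignType) (u : Neuron A n) : Neuron A (n * c) :=
  ⟨u.act, u.bias, blk fun j γ => (σ γ : ℚ) * u.weight j⟩

theorem encNeuron_expand {n c : ℕ} (σ : Fin c → SignType) (u : Neuron A n) :
    encNeuron name (u.expand σ) = neuronStr name (List.ofFn σ) u := by
  simp only [encNeuron, neuronStr, Neuron.expand, encVec, ofFn_blk, List.flatMap_assoc]
  rw [List.ofFn_eq_map (f := u.weight), List.flatMap_map]
  congr 2
  refine List.flatMap_congr fun j _ => ?_
  rw [multStr, List.ofFn_eq_map, List.ofFn_eq_map, List.flatMap_map, List.flatMap_map]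

/-- The layer in which every node occurs twice, with different expansions of its inputs. -/
def dupLayer {n k c : ℕ} (σ : Fin 2 → Fin c → SignType) (layer : Fin k → Neuron A n) :
    Fin (k * 2) → Neuron A (n * c) :=
  blk fun i ρ => (layer i).expand (σ ρ)

theorem encLayer_dupLayer {n k c : ℕ} (σ : Fin 2 → Fin c → SignType)
    (layer : Fin k → Neuron A n) : encLayer name (dupLayer σ layer) =
      layerStr name (List.ofFn (σ 0)) (some (List.ofFn (σ 1))) layer := by
  rw [encLayer, dupLayer, ofFn_blk, List.flatMap_assoc, layerStr, List.ofFn_eq_map (f := layer),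
    List.flatMap_map]
  congr 1
  refine List.flatMap_congr fun i _ => ?_
  simp [encNeuron_expand, neuronsStr]

/-- The network that runs two copies of `N` on interleaved inputs, and then `rest`. -/
def Net.double : {n m q : ℕ} → Net A n m → Net A (m * 2) q → Net A (n * 2) q
  | _, _, _, .output layer, fin => .hidden (dupLayer ![![1, 0], ![0, 1]] layer) fin
  | _, _, _, .hidden layer rest, fin => .hidden (dupLayer ![![1, 0], ![0, 1]] layer)
      (rest.double fin)

theorem encNet_double {n m q : ℕ} (N : Net A n m) (fin : Net A (m * 2) q) :
    encNet name (N.double fin) = doubledStr name N ++ encNet name fin := by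
  induction N with
  | output layer =>
    rw [Net.double, encNet, encLayer_dupLayer, doubledStr]
    rfl
  | hidden layer rest ih =>
    rw [Net.double, encNet, encLayer_dupLayer, doubledStr, ih, List.append_assoc]
    rfl

/-- The network that runs two copies of `N`, where the inputs of each copy are represented as
differences, and then `rest`. -/
def Net.doublePairs : {n m q : ℕ} → Net A n m → Net A (m * 2) q → Net A (n * 4) q
  | _, _, _, .output layer, fin =>
    .hidden (dupLayer ![![1, -1, 0, 0], ![0, 0, 1, -1]] layer) fin
  | _, _, _, .hidden layer rest, fin =>
    .hidden (dupLayer ![![1, -1, 0, 0], ![0, 0, 1, -1]] layer) (rest.double fin)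

/-- The network that runs `N` on inputs that are represented as differences. -/
def Net.pairs : {n m : ℕ} → Net A n m → Net A (n * 2) m
  | _, _, .output layer => .output fun i => (layer i).expand ![1, -1]
  | _, _, .hidden layer rest => .hidden (fun i => (layer i).expand ![1, -1]) rest

theorem encLayer_expand {n k : ℕ} (layer : Fin k → Neuron A n) :
    encLayer name (fun i => (layer i).expand ![1, -1]) = layerStr name [1, -1] none layer := by
  rw [encLayer, layerStr, List.ofFn_eq_map, List.ofFn_eq_map, List.flatMap_map, List.flatMap_map]
  congr 1
  refine List.flatMap_congr fun i _ => ?_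
  rw [encNeuron_expand, neuronsStr]
  simp

/-- The weights of a network with three layers of rectified linear units that maps the space onto a
ball. -/
structure BallMap where
  middle : Band 3 2
  last : Fin 3 → ℚ

/-- The first layer computes positive and negative parts. -/
def partsBand : Band 2 1 := ⟨0, ![![1], ![-1]]⟩

/-- The last layer for one point, represented as differences. -/
def BallMap.band₂ (T : BallMap) : Band 2 3 := ⟨0, ![T.last, -T.last]⟩

/-- The last layer for a point and the center, represented as differences. -/
def BallMap.band₄ (T : BallMap) : Band 4 3 := ⟨0, ![T.last, -T.last, 0, 0]⟩

/-- The network that maps the inputs to a ball, and then runs `rest`. -/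
def BallMap.net {n r m : ℕ} (T : BallMap) (σ : A) (β : ℚ) (B : Band r 3)
    (s : Fin r → SignType) (c : Fin n → ℚ) (rest : Net A (n * r) m) : Net A (n * 1) m :=
  .hidden (bandLayer σ partsBand fun (_ : Fin n) _ => 0) <|
    .hidden (bandLayer σ T.middle fun (_ : Fin n) _ => β) <|
      .hidden (bandLayer σ B fun k ρ => (s ρ : ℚ) * c k) rest

/-- The comparison of pairs of nodes. -/
def cmpBand : Band 2 2 := ⟨0, ![![1, -1], ![-1, 1]]⟩

/-- The network that sums up the differences of pairs of nodes that exceed `-d`. -/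
def cmpNet (σ : A) (m : ℕ) (d : ℚ) : Net A (m * 2) 1 :=
  .hidden (bandLayer σ cmpBand fun (_ : Fin m) _ => d)
    (.output fun _ => ⟨σ, 0, blk fun _ _ => 1⟩)

/-- The maps onto balls of finite radius. -/
noncomputable def ballMap (p : ENNReal) : BallMap :=
  if p = 1 then ⟨⟨fun _ _ => -1, ![![0, 0], ![-1, 0], ![-1, -1]]⟩, ![1, -2, 1]⟩
  else ⟨⟨0, ![![0, 0], ![-1, 0], ![0, -1]]⟩, ![0, -1, 1]⟩

/-- The map onto the ball of infinite radius. -/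
def freeMap : BallMap := ⟨⟨0, ![![0, 0], ![1, 0], ![0, 1]]⟩, ![0, 1, -1]⟩

/-- The map onto a ball. -/
noncomputable def tolMap (p : ENNReal) : WithTop NNRat → BallMap
  | ⊤ => freeMap
  | (_ : NNRat) => ballMap p

/-- The finite part of a tolerance. -/
def tolRat : WithTop NNRat → ℚ
  | ⊤ => 0
  | (q : NNRat) => q

/-- The reduction of classification robustness. -/
noncomputable def mapCR (p : ENNReal) (σ : A) (I : CRInstance A) : CRInstance A where
  net := (tolMap p I.eps).net σ (tolRat I.eps) (tolMap p I.eps).band₂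
    ![1, -1] I.center I.net.pairs
  eps := ⊤
  center := fun _ => 0
  label := I.label

/-- The reduction of arbitrary classification robustness. -/
noncomputable def mapACR (p : ENNReal) (σ : A) (I : ACRInstance A) : ACRInstance A where
  net := (tolMap p I.eps).net σ (tolRat I.eps) (tolMap p I.eps).band₂
    ![1, -1] I.center I.net.pairs
  eps := ⊤
  center := fun _ => 0

/-- The tolerance of the reduced instance of standard robustness. -/
noncomputable def mapTol (p : ENNReal) (δ : WithTop NNRat) : WithTop NNRat :=
  if p = 1 then δ else δ.map fun _ => 0

/-- The bias of the comparison in the reduced instance of standard robustness. -/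
noncomputable def cmpBias (p : ENNReal) (δ : WithTop NNRat) : ℚ :=
  if p = 1 then 0 else -tolRat δ

/-- The reduction of standard robustness. -/
noncomputable def mapSR (p : ENNReal) (σ : A) (I : SRInstance A) : SRInstance A where
  net := (tolMap p I.eps).net σ (tolRat I.eps) (tolMap p I.eps).band₄
    ![1, -1, 1, -1] I.center
    (I.net.doublePairs (cmpNet σ _ (cmpBias p I.delta)))
  eps := ⊤
  delta := mapTol p I.delta
  center := fun _ => 0

end NeuralNet

/-! ### Programs that read centers and tolerances and write the ball map. -/

namespace NeuralNet

open Function Turing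

namespace Prog

open Stk

/-- Reads a vector from `inp` into `cen`, pushes the zero vector on `acc`, and stores the dimension
in `todo`. -/
def centerProg : Prog Stk :=
  loop inp isClose (fun s => push inp [s] ;; readTo inp rcen acc (fun _ => []) ;;
    push acc (encRat 0) ;; push todo [.comma]) ;; push acc [.close] ;; move rcen cen

theorem run_readRat_single {src d d' : Stk} (h : src ≠ d) (h' : src ≠ d') (hd : d ≠ d') {q : ℚ}
    {rest : List Sym} {S : Stk → List Sym} (hS : S src = encRat q ++ rest) :
    Run (readTo src d d' fun _ => []) S (3 * (encRat q).length)
      (app (update S src rest) d (encRat q)) := by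
  refine (run_readRat h h' hd (fun _ => []) hS).congr ?_ le_rfl
  rw [show (encRat q).flatMap (fun _ => ([] : List Sym)) = [] by simp, app_nil]

theorem run_unpop {k : Stk} {S : Stk → List Sym} {s : Sym} {l : List Sym} (h : S k = s :: l) :
    Run (push k [s]) (update S k l) 1 S := by
  refine Run.push.congr ?_ le_rfl
  ext1 j
  rcases eq_or_ne j k with rfl | hj
  · simp [h]
  · simp [app, hj]

theorem run_center_loop {cs : List ℚ} {rest : List Sym} {S : Stk → List Sym}
    (hin : S inp = cs.flatMap encRat ++ .close :: rest) :
    Run (loop inp isClose (fun s => push inp [s] ;; readTo inp rcen acc (fun _ => []) ;;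
      push acc (encRat 0) ;; push todo [.comma])) S (7 * (cs.flatMap encRat).length + 1)
      (app (app (app (update S inp rest) rcen (cs.flatMap encRat)) acc
        (List.replicate cs.length (encRat 0)).flatten) todo
        (List.replicate cs.length .comma)) := by
  induction cs generalizing S with
  | nil => exact (Run.loop_exit (by simp [hin, isClose])).congr (by simp [hin]) (by simp)
  | cons q cs ih =>
    obtain ⟨s, l, hw, hs⟩ := encRat_ne q
    have hin' := hin
    rw [List.flatMap_cons, hw, List.append_assoc, List.cons_append] at hin'
    rw [List.flatMap_cons, List.append_assoc] at hin
    refine (Run.loop_step hin' hs (.seq (run_unpop hin') <|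
      .seq (run_readRat_single (by decide) (by decide) (by decide) hin) <| .seq .push .push)
      (ih ?_)).congr ?_ ?_
    · simp [app]
    · ext1 k
      cases k <;> simp [app, List.replicate_succ, replicate_append_cons]
    · have := congrArg List.length hw
      simp only [List.length_cons, List.flatMap_cons, List.length_append] at this ⊢
      omega

theorem encVec_zero (n : ℕ) :
    encVec (fun _ : Fin (n * 1) => 0) = (List.replicate n (encRat 0)).flatten ++ [.close] := by
  rw [encVec, List.ofFn_const, mul_one]
  simp [List.flatMap]

theorem run_center {n : ℕ} {c : Fin n → ℚ} {rest : List Sym} {S : Stk → List Sym}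
    (hr : S rcen = []) (hc : S cen = []) (ht : S todo = []) (hin : S inp = encVec c ++ rest) :
    Run centerProg S (10 * (encVec c).length)
      (app (update (update (update S inp rest) cen ((List.ofFn c).flatMap encRat)) todo
        (List.replicate n .comma)) acc (encVec fun _ : Fin (n * 1) => 0)) := by
  refine (Run.seq (run_center_loop (cs := List.ofFn c) (rest := rest) (by simp [hin, encVec]))
    (.seq .push (run_move (by decide) _))).congr ?_ ?_
  · rw [encVec_zero]
    ext1 k
    cases k <;> simp [app, hr, hc, ht]
  · simp [app, hr, encVec, -List.length_flatMap]
    omega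

/-- Reads a tolerance from `inp`, stores its finite part in `rad`, and continues with a program that
depends on the tolerance being finite. -/
noncomputable def tolProg (p : ENNReal) (next : BallMap → Prog Stk) : Prog Stk :=
  pop inp fun
    | none => push acc []
    | some .infty => push rad (encRat 0) ;; next freeMap
    | some s => push inp [s] ;; readTo inp rad acc (fun _ => []) ;; next (ballMap p)

theorem encRat_cons (q : ℚ) : ∃ s l, encRat q = s :: l ∧ (s = .plus ∨ s = .minus) := by
  simp only [encRat]
  split_ifs
  · exact ⟨_, _, rfl, .inr rfl⟩
  · exact ⟨_, _, rfl, .inl rfl⟩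

/-- The code of a finite tolerance starts with a sign, so one pop separates it from `∞`. The ball
map is then remembered by the control, with one continuation for each of the two cases. -/
theorem run_tol {p : ENNReal} {next : BallMap → Prog Stk} {ε : WithTop NNRat} {rest : List Sym}
    {S S' : Stk → List Sym} {t : ℕ} (hin : S inp = encTol ε ++ rest)
    (h : Run (next (tolMap p ε)) (app (update S inp rest) rad (encRat (tolRat ε))) t S') :
    Run (tolProg p next) S (3 * (encTol ε).length + 2 + t) S' := by
  cases ε with
  | top =>
    refine (Run.pop (t := 1 + t) ?_).mono (by omega)
    rw [hin]
    exact .seq .push h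
  | coe q =>
    have hin₀ : S inp = encRat q ++ rest := hin
    obtain ⟨s, l, hl, hs⟩ := encRat_cons q
    have key : Run (push inp [s] ;; readTo inp rad acc (fun _ => []) ;;
        next (ballMap p)) (update S inp (l ++ rest)) (1 + (3 * (encRat q).length + t))
        S' := by
      refine .seq (run_unpop ?_) (.seq (run_readRat_single (by decide) (by decide) (by decide) hin₀)
        h)
      rw [hin₀, hl]; rfl
    refine (Run.pop (t := 1 + (3 * (encRat q).length + t)) ?_).mono (by
      change _ ≤ 3 * (encRat q).length + 2 + t; omega)
    rw [hin₀]
    rw [hl] at key ⊢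
    rcases hs with rfl | rfl <;> exact key

/-- Reads the output tolerance from `inp`, pushes the modified tolerance on `acc`, and stores the
bias of the comparison layer in `thr`. -/
noncomputable def outTolProg (p : ENNReal) : Prog Stk :=
  if p = 1 then
    push thr (encRat 0) ;; pop inp fun
      | none => push acc []
      | some .infty => push acc [.infty]
      | some s => push inp [s] ;; readTo inp acc acc' (fun _ => [])
  else
    pop inp fun
      | none => push acc []
      | some .infty => push acc [.infty] ;; push thr (encRat 0)
      | some s => push inp [s] ;; readTo inp num acc (fun _ => []) ;; neg num aux thr ;;
          clear num ;; push acc (encRat 0)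

/-- As `p` is fixed, the distinction `p = 1` selects a program and costs no time. In the other case
a finite tolerance is written as `0`, and its negation goes to `thr`. -/
theorem run_outTol {p : ENNReal} {δ : WithTop NNRat} {rest : List Sym} {S : Stk → List Sym}
    (hS : S aux = []) (hnum : S num = []) (hin : S inp = encTol δ ++ rest) :
    Run (outTolProg p) S (30 * (encTol δ).length)
      (app (app (update S inp rest) acc (encTol (mapTol p δ))) thr (encRat (cmpBias p δ))) := by
  unfold outTolProg mapTol cmpBias
  split_ifs with hp
  · cases δ with
    | top =>
      refine (Run.seq .push (.pop (t := 1) (S' := app (app (update S inp rest) acc (encTol ⊤)) thr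
        (encRat 0)) ?_)).mono (by simp [encTol])
      rw [app_of_ne (by decide), hin]
      refine Run.push.congr ?_ le_rfl
      ext1 k
      cases k <;> simp [app, encTol]
    | coe q =>
      have hin₀ : S inp = encRat q ++ rest := hin
      obtain ⟨s, l, hl, hs⟩ := encRat_cons q
      have key : Run (push inp [s] ;; readTo inp acc acc' (fun _ => []))
          (update (app S thr (encRat 0)) inp (l ++ rest))
          (1 + 3 * (encRat q).length)
          (app (app (update S inp rest) acc (encRat q)) thr (encRat 0)) := by
        refine (Run.seq (run_unpop ?_) (run_readRat_single (by decide) (by decide) (by decide)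
          (q := q) (rest := rest) ?_)).congr ?_ le_rfl
        · rw [app_of_ne (by decide), hin₀, hl]
          rfl
        · rw [app_of_ne (by decide), hin₀]
        · ext1 k
          cases k <;> simp [app]
      refine (Run.seq .push (.pop (t := 1 + 3 * (encRat q).length) (S' := app (app (update S inp
        rest) acc (encRat q)) thr (encRat 0)) ?_)).mono ?_
      · rw [app_of_ne (by decide), hin₀]
        rw [hl] at key ⊢
        rcases hs with rfl | rfl <;> exact key
      · have := length_encRat_pos q
        change _ ≤ 30 * (encRat q).length
        omega
  · cases δ with
    | top =>
      refine (Run.pop (t := 1 + 1) (S' := app (app (update S inp rest) acc (encTol ⊤)) thr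
        (encRat 0)) ?_).congr (by simp [tolRat]) (by simp [encTol])
      rw [hin]
      exact Run.seq .push .push
    | coe q =>
      have hin₀ : S inp = encRat q ++ rest := hin
      obtain ⟨s, l, hl, hs⟩ := encRat_cons q
      have key : Run (push inp [s] ;; readTo inp num acc (fun _ => []) ;;
          neg num aux thr ;; clear num ;; push acc (encRat 0))
          (update S inp (l ++ rest)) (11 * (encRat q).length + 9)
          (app (app (update S inp rest) acc (encRat 0)) thr (encRat (-q))) := by
        refine (Run.seq (run_unpop ?_) <| .seq (run_readRat_single (by decide) (by decide)
          (by decide) hin₀) <| .seq (emits_neg (by decide) (by decide) (by decide) ?_) <|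
          .seq (run_clear _ _) .push).congr ?_ ?_
        · rw [hin₀, hl]; rfl
        · simpa [app]
        · ext1 k
          cases k <;> simp [app, hnum, encRat_neg]
        · simp [app, hnum]
          omega
      refine (Run.pop (t := 11 * (encRat q).length + 9) (S' := app (app (update S inp rest) acc
        (encRat 0)) thr (encRat (-q))) ?_).congr ?_ ?_
      · rw [hin₀]
        rw [hl] at key ⊢
        rcases hs with rfl | rfl <;> exact key
      · rw [WithTop.map_coe]
        simp [encTol, tolRat]
      · have := length_encRat_pos q
        change _ ≤ 30 * (encRat q).length
        omega

section Net

variable {A : Type} (name : A → List Bool)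

/-- Pushes the layers that map the space onto a ball on `acc`. -/
def ballProg (pre : List Sym) (T : BallMap) {r : ℕ} (B : Band r 3) (s : Fin r → SignType) :
    Prog Stk :=
  band pre (partsBand.rows fun _ => .const (encRat 0)) ;;
    band pre (T.middle.rows fun _ => .copy rad) ;; bandRead pre (B.rows fun ρ => signItem (s ρ))

theorem mem_rows {r c : ℕ} {B : Band r c} {it : Fin r → Item Stk} {R : Row} (h : R ∈ B.rows it) :
    ∃ ρ, R.bias = it ρ := by
  obtain ⟨ρ, rfl⟩ := (List.mem_ofFn' _ _).mp h
  exact ⟨ρ, rfl⟩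

theorem length_rows {r c : ℕ} (B : Band r c) (it : Fin r → Item Stk) : (B.rows it).length = r :=
  List.length_ofFn

theorem emits_bandLayer (σ : A) {n r c : ℕ} (B : Band r c) (bias : Fin n → Fin r → ℚ)
    (it : Fin r → Item Stk) {b : ℕ} {S : Stk → List Sym}
    (hn : S todo = List.replicate n .comma) (hS : S aux = []) (hs : S seen = [])
    (hit : ∀ ρ, (it ρ).Reads fun k => k ≠ aux ∧ k ≠ acc ∧ k ≠ todo ∧ k ≠ seen)
    (hb : ∀ ρ, (it ρ).cost S ≤ b) (hbias : ∀ k ρ, (it ρ).str S = encRat (bias k ρ)) :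
    Emits (band (actStr name σ) (B.rows it)) acc S (n * (r * (b + 5 * n + 7) + 5) + 3)
      (encLayer name (bandLayer σ B bias)) := by
  rw [encLayer_bandLayer name σ B bias it (fun _ => S) hbias]
  refine (emits_band hn hS hs (b := b) ?_ ?_).mono (by rw [length_rows])
  · intro R hR
    obtain ⟨ρ, h⟩ := mem_rows hR
    exact h ▸ hit ρ
  · intro R hR
    obtain ⟨ρ, h⟩ := mem_rows hR
    exact h ▸ hb ρ

theorem run_bandLayer (σ : A) {n r c : ℕ} (B : Band r c) (s : Fin r → SignType) {x : Fin n → ℚ}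
    {b : ℕ} {S : Stk → List Sym}
    (hn : S todo = List.replicate n .comma) (hS : S aux = []) (hs : S seen = [])
    (hnum : S num = []) (hcen : S cen = (List.ofFn x).flatMap encRat)
    (hx : ∀ i, (encRat (x i)).length ≤ b) :
    Run (bandRead (actStr name σ) (B.rows fun ρ => signItem (s ρ))) S
      (n * (r * (5 * b + 6 + 5 * n + 7) + 5 * (5 * b + 6) + 6) + 3)
      (app (update S cen []) acc
        (encLayer name (bandLayer σ B fun k ρ => (s ρ : ℚ) * x k))) := by
  rw [encLayer_bandLayer name σ B _ (fun ρ => signItem (s ρ))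
    (fun k => update S num (encRat (x k)).reverse) fun k ρ => str_signItem (by simp) _]
  refine (run_bandRead (x := x) (b := 5 * b + 6) hn hS hs hnum hcen ?_ ?_ ?_).mono
    (by rw [length_rows])
  · intro R hR
    obtain ⟨ρ, h⟩ := mem_rows hR
    rw [h]
    exact reads_signItem (by decide) _
  · intro R hR i
    obtain ⟨ρ, h⟩ := mem_rows hR
    have := hx i
    rw [h]
    cases s ρ <;> simp [signItem, Item.cost, this]
  · intro i
    have := hx i
    omega

/-- Only the prefix `l` for the three new layers is written here; the code of `N` is appended later.
Each layer has boundedly many rows per coordinate, each of length linear in `b`, whence the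
quadratic bound. -/
theorem run_ball (σ : A) (T : BallMap) {n r m : ℕ} (hr : r ≤ 4) (B : Band r 3)
    (s : Fin r → SignType) {c : Fin n → ℚ} {β : ℚ} (N : Net A (n * r) m) {b : ℕ}
    {S : Stk → List Sym}
    (hn : S todo = List.replicate n .comma) (hS : S aux = []) (hs : S seen = [])
    (hnum : S num = []) (hcen : S cen = (List.ofFn c).flatMap encRat)
    (hrad : S rad = (encRat β).reverse) (hβ : (encRat β).length ≤ b)
    (hc : ∀ i, (encRat (c i)).length ≤ b) (hnb : n ≤ b) :
    ∃ l, encNet name (T.net σ β B s c N) = l ++ encNet name N ∧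
      Run (ballProg (actStr name σ) T B s) S (300 * (b + 1) ^ 2)
        (app (update S cen []) acc l) := by
  have h1 := emits_bandLayer name σ partsBand (fun (_ : Fin n) _ => 0)
    (fun _ => .const (encRat 0)) (b := 1) hn hS hs (fun _ => trivial) (fun _ => le_rfl)
    (fun _ _ => rfl)
  have h2 := emits_bandLayer name σ T.middle (fun (_ : Fin n) _ => β)
    (fun _ => .copy rad) (b := 5 * b + 6) (S := app S acc (encLayer name
      (bandLayer σ partsBand fun (_ : Fin n) _ => 0))) (by simpa [app_of_ne])
    (by simpa [app_of_ne]) (by simpa [app_of_ne]) (fun _ => by simp [Item.Reads])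
    (fun _ => by simpa [Item.cost, app_of_ne, hrad])
    (fun _ _ => by simp [Item.str, app_of_ne, hrad])
  have h3 := run_bandLayer name σ B s (x := c) (b := b) (S := app (app S acc (encLayer name
      (bandLayer σ partsBand fun (_ : Fin n) _ => 0))) acc (encLayer name
      (bandLayer σ T.middle fun (_ : Fin n) _ => β))) (by simpa [app_of_ne])
    (by simpa [app_of_ne]) (by simpa [app_of_ne]) (by simpa [app_of_ne]) (by simpa [app_of_ne]) hc
  refine ⟨encLayer name (bandLayer σ partsBand fun (_ : Fin n) _ => 0) ++
      (encLayer name (bandLayer σ T.middle fun (_ : Fin n) _ => β) ++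
      encLayer name (bandLayer σ B fun k ρ => (s ρ : ℚ) * c k)), ?_,
      (Run.seq h1 (.seq h2 h3)).congr ?_ ?_⟩
  · simp [BallMap.net, encNet]
  · ext1 k
    cases k <;> simp [app]
  -- Replacing `n` by `b` and `r` by `4` leaves an inequality between polynomials in `b` alone.
  · have h1 : n * (2 * (1 + 5 * n + 7) + 5) ≤ b * (2 * (1 + 5 * b + 7) + 5) := by gcongr
    have h2 : n * (3 * (5 * b + 6 + 5 * n + 7) + 5) ≤
        b * (3 * (5 * b + 6 + 5 * b + 7) + 5) := by gcongr
    have h3 : n * (r * (5 * b + 6 + 5 * n + 7) + 5 * (5 * b + 6) + 6) ≤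
        b * (4 * (5 * b + 6 + 5 * b + 7) + 5 * (5 * b + 6) + 6) := by gcongr
    nlinarith

/-- Only the first layer changes, so the rest `r` of the code can be copied verbatim. -/
theorem encNet_pairs {n m : ℕ} (N : Net A n m) :
    ∃ (k : ℕ) (layer : Fin k → Neuron A n) (r : List Sym), encNet name N =
      encLayer name layer ++ r ∧ encNet name N.pairs = layerStr name [1, -1] none layer ++ r := by
  cases N with
  | output layer =>
    exact ⟨_, layer, [.finish], rfl, by rw [Net.pairs, encNet, encLayer_expand]⟩
  | hidden layer rest =>
    exact ⟨_, layer, encNet name rest, rfl, by rw [Net.pairs, encNet, encLayer_expand]⟩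

/-- The program that computes `mapCR` and `mapACR`. -/
noncomputable def classProg (p : ENNReal) (pre : List Sym) : Prog Stk :=
  centerProg ;; push acc [.infty] ;; tolProg p fun T =>
    ballProg pre T T.band₂ ![1, -1] ;; layerProg [1, -1] none ;; move inp acc ;; clear rad ;;
    clear todo ;; clear width

theorem length_le_encVec {n : ℕ} (c : Fin n → ℚ) :
    n ≤ (encVec c).length ∧ ∀ i, (encRat (c i)).length ≤ (encVec c).length := by
  have key : ∀ l : List ℚ, l.length ≤ (l.flatMap encRat).length ∧
      ∀ q ∈ l, (encRat q).length ≤ (l.flatMap encRat).length := by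
    intro l
    induction l with
    | nil => simp
    | cons q l ih =>
      have := length_encRat_pos q
      simp only [List.flatMap_cons, List.length_append, List.length_cons, List.mem_cons]
      refine ⟨by omega, ?_⟩
      rintro q' (rfl | hq')
      · omega
      · have := ih.2 q' hq'
        omega
  obtain ⟨h1, h2⟩ := key (List.ofFn c)
  rw [List.length_ofFn] at h1
  rw [encVec, List.length_append]
  exact ⟨by omega, fun i => (h2 _ (List.mem_ofFn' _ _ |>.mpr ⟨i, rfl⟩)).trans (by omega)⟩

/-- The factor `4` is needed for `∞`, a single symbol, whose finite part `0` takes four. -/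
theorem length_tolRat_le (ε : WithTop NNRat) :
    (encRat (tolRat ε)).length ≤ 4 * (encTol ε).length := by
  cases ε with
  | top => simp [tolRat, encRat_zero, encTol]
  | coe q => exact Nat.le_mul_of_pos_left _ (by norm_num)

theorem length_encTol_pos (ε : WithTop NNRat) : 1 ≤ (encTol ε).length := by
  cases ε with
  | top => simp [encTol]
  | coe q => exact length_encRat_pos _

end Net

end Prog
end NeuralNet

/-! ### Polynomial running time of the reductions. -/

namespace NeuralNet

open Function Turing

namespace Prog

/-- A bound for the number of symbols pushed in one step. -/
def rate {K : Type} : Prog K → ℕ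
  | push _ s => s.length
  | pop _ next => ∑ o, rate (next o)
  | seq p q => rate p + rate q
  | loop _ _ body => ∑ s, rate (body s)

/-- A step adds at most `rate p` symbols to a stack, so a time bound is also a bound for the output
length. -/
theorem Run.length_le {K : Type} [DecidableEq K] {p : Prog K} {S S' : K → List Sym} {t : ℕ}
    (h : Run p S t S') (k : K) : (S' k).length ≤ (S k).length + t * rate p := by
  induction h with
  | @push j s S =>
    rcases eq_or_ne k j with rfl | hk
    · simp [rate, add_comm]
    · simp [app_of_ne hk]
  | @pop j next S t S' h ih =>
    have h1 : rate (next (S j).head?) ≤ rate (.pop j next) :=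
      Finset.single_le_sum (f := fun o => rate (next o)) (by simp) (Finset.mem_univ _)
    have h2 : (update S j (S j).tail k).length ≤ (S k).length := by
      rcases eq_or_ne k j with rfl | hk
      · simp
      · simp [hk]
    have h3 := Nat.mul_le_mul_left t h1
    rw [add_mul]
    omega
  | @seq p q S S' S'' t t' h h' ih ih' =>
    have h1 : t * rate p ≤ t * rate (p ;; q) := Nat.mul_le_mul_left _ (by simp [rate])
    have h2 : t' * rate q ≤ t' * rate (p ;; q) := Nat.mul_le_mul_left _ (by simp [rate])
    rw [add_mul]
    omega
  | @loop_exit j halts body S h =>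
    rcases eq_or_ne k j with rfl | hk
    · simp; omega
    · simp [hk]
  | @loop_step j halts body S s l S' S'' t t' hk hs h h' ih ih' =>
    have h1 : rate (body s) ≤ rate (.loop j halts body) :=
      Finset.single_le_sum (f := fun s => rate (body s)) (by simp) (Finset.mem_univ _)
    have h2 : (update S j l k).length ≤ (S k).length := by
      rcases eq_or_ne k j with rfl | hk'
      · simp [hk]
      · simp [hk']
    have h3 := Nat.mul_le_mul_left t h1
    rw [add_mul, add_mul]
    omega
  | mono h ht ih => exact ih.trans (by gcongr)

open Stk

/-- The programs leave the output on `acc` with its last symbol on top. The final move reverses it,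
in time proportional to its length, which `Run.length_le` bounds. -/
theorem nonempty_polyTime_of_run {α β : Type} {ea : α → List Sym} {eb : β → List Sym}
    {f : α → β} (p : Prog Stk) (C : ℕ) (h : ∀ a, Run p (only inp (ea a))
      (C * ((ea a).length + 1) ^ 2) (only acc (eb (f a)).reverse)) :
    Nonempty (TM2ComputableInPolyTime ea eb f) := by
  refine nonempty_polyTime inp out (p ;; move acc out)
    (.C C * (.X + 1) ^ 2 * .C (1 + 2 * rate p) + 1) fun a => ?_
  refine (Run.seq (h a) (run_move (by decide) _)).congr ?_ ?_
  · ext1 k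
    cases k <;> simp [only, app]
  · have := (h a).length_le acc
    simp only [only, update_self, ne_eq, reduceCtorEq, not_false_eq_true, update_of_ne,
      List.length_nil, zero_add] at this ⊢
    simp only [Polynomial.eval_add, Polynomial.eval_mul, Polynomial.eval_C, Polynomial.eval_pow,
      Polynomial.eval_X, Polynomial.eval_one]
    rw [mul_add]
    linarith

section Net

variable {A : Type} (name : A → List Bool)

/-- The string `tail` leaves room for the label, which is copied together with the unchanged layers.
-/
theorem run_class (p : ENNReal) (σ : A) {n m : ℕ} (N : Net A n m) (ε : WithTop NNRat)
    (c : Fin n → ℚ) (tail : List Sym) {L : ℕ}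
    (hL : L = (encVec c ++ encTol ε ++ encNet name N ++ tail).length) :
    Run (classProg p (actStr name σ)) (only inp (encVec c ++ encTol ε ++ encNet name N ++ tail))
      (20000 * (L + 1) ^ 2) (only acc (encVec (fun _ : Fin (n * 1) => 0) ++ encTol ⊤ ++
        encNet name ((tolMap p ε).net σ (tolRat ε) (tolMap p ε).band₂ ![1, -1] c N.pairs) ++
          tail).reverse) := by
  obtain ⟨k, layer, r, hN, hN'⟩ := encNet_pairs name N
  obtain ⟨hn, hc⟩ := length_le_encVec c
  have hε := length_tolRat_le ε
  simp only [List.length_append] at hL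
  set S₀ := only inp (encVec c ++ encTol ε ++ encNet name N ++ tail)
  have h1 := run_center (c := c) (S := S₀) (rest := encTol ε ++ (encNet name N ++ tail))
    (by simp [S₀, only]) (by simp [S₀, only]) (by simp [S₀, only]) (by simp [S₀, only])
  set S₁ := app (update (update (update S₀ inp (encTol ε ++ (encNet name N ++ tail))) cen
    ((List.ofFn c).flatMap encRat)) todo (List.replicate n .comma)) acc
    (encVec fun _ : Fin (n * 1) => 0) with hS₁
  set S₂ := app S₁ acc [.infty] with hS₂
  set S₃ := app (update S₂ inp (encNet name N ++ tail)) rad (encRat (tolRat ε)) with hS₃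
  obtain ⟨l, hl, h3⟩ := run_ball name σ (tolMap p ε) (by norm_num) (tolMap p ε).band₂ ![1, -1]
    (c := c) (β := tolRat ε) N.pairs (S := S₃) (b := 4 * L) (by simp [S₃, S₂, S₁, app])
    (by simp [S₃, S₂, S₁, S₀, app, only]) (by simp [S₃, S₂, S₁, S₀, app, only])
    (by simp [S₃, S₂, S₁, S₀, app, only]) (by simp [S₃, S₂, S₁, app])
    (by simp [S₃, S₂, S₁, S₀, app, only]) (by omega) (fun i => (hc i).trans (by omega)) (by omega)
  set S₄ := app (update S₃ cen []) acc l with hS₄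
  have h4 := run_layer name (σ := [1, -1]) (σ' := none) (by simp) (by simp) (layer := layer)
    (rest := r ++ tail) (S := S₄) (by simp [S₄, S₃, S₂, S₁, S₀, app, only])
    (by simp [S₄, S₃, S₂, S₁, S₀, app, only]) (by simp [S₄, S₃, S₂, S₁, S₀, app, only])
    (by simp [S₄, S₃, S₂, S₁, app, hN])
  refine (Run.seq h1 <| .seq (.push (S := S₁)) <| run_tol (S := S₂)
    (rest := encNet name N ++ tail) (by simp [S₂, S₁, app]) (.seq h3 <| .seq h4 <|
    .seq (run_move (by decide) _) <| .seq (run_clear _ _) <| .seq (run_clear _ _) <|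
    run_clear _ _)).congr ?_ ?_
  · rw [hl, hN']
    ext1 k
    cases k <;> simp [S₄, S₃, S₂, S₁, S₀, app, only, encTol]
  · have hk : k ≤ (encLayer name layer).length := (length_lt_encLayer name layer).le
    have hr := congrArg List.length hN
    rw [List.length_append] at hr
    simp [S₄, S₃, S₂, S₁, S₀, app, only, -List.length_flatMap]
    nlinarith

/-- The first layer is separate because it has four inputs per coordinate, the parts of the point
and of the center, while later layers have two per node. If there is no later layer, `doubleProg`
meets the final symbol at once. -/
theorem run_doublePairs {n m : ℕ} (N : Net A n m) {S : Stk → List Sym}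
    (hS : S aux = []) (hnum : S num = []) (hacc : S acc' = []) (hw : S width = [])
    (hin : S inp = encNet name N) :
    ∃ l, (∀ (q : ℕ) (fin : Net A (m * 2) q),
        encNet name (N.doublePairs fin) = l ++ encNet name fin) ∧
      Run (layerProg [1, -1, 0, 0] (some [0, 0, 1, -1]) ;; doubleProg) S
        (300 * (encNet name N).length) (app (app (update S inp []) acc l) width
          (List.replicate m .comma)) := by
  cases N with
  | output layer =>
    refine ⟨layerStr name [1, -1, 0, 0] (some [0, 0, 1, -1]) layer, fun q fin => ?_,
      (Run.seq (run_layer name (by simp) (by simp) hS hnum hacc hin) (.loop_exit ?_)).congr ?_ ?_⟩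
    · rw [Net.doublePairs, encNet, encLayer_dupLayer]
      rfl
    · simp [app, isFinish]
    · ext1 k
      cases k <;> simp [app]
    · simp [encNet]
      omega
  | @hidden _ k _ layer N =>
    have h1 := run_layer name (σ := [1, -1, 0, 0]) (σ' := some [0, 0, 1, -1]) (by simp) (by simp)
      hS hnum hacc hin
    refine ⟨layerStr name [1, -1, 0, 0] (some [0, 0, 1, -1]) layer ++ doubledStr name N,
      fun q fin => ?_, (Run.seq h1 (run_double name N (rest := []) ?_ ?_ ?_ ?_)).congr ?_ ?_⟩
    · rw [Net.doublePairs, encNet, encLayer_dupLayer, encNet_double, List.append_assoc]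
      rfl
    · simpa [app]
    · simpa [app]
    · simpa [app]
    · simp [app]
    · ext1 k
      cases k <;> simp [app, hw]
    · have := length_lt_encLayer name layer
      simp [encNet, app, hw]
      omega

/-- Pushes the comparison layer and the output layer on `acc`. -/
def cmpProg (pre : List Sym) : Prog Stk :=
  band pre (cmpBand.rows fun _ => .copy thr) ;; push acc (pre ++ encRat 0) ;;
    rep todo aux acc (encs fun _ : Fin 2 => 1) ;; push acc [.close, .close, .finish]

theorem encNet_cmpNet (σ : A) (m : ℕ) (d : ℚ) : encNet name (cmpNet σ m d) =
    encLayer name (bandLayer σ cmpBand fun (_ : Fin m) _ => d) ++ ((actStr name σ ++ encRat 0) ++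
      ((List.replicate m (encs fun _ : Fin 2 => 1)).flatten ++ [.close, .close, .finish])) := by
  have : (List.ofFn (blk fun (_ : Fin m) (_ : Fin 2) => (1 : ℚ))).flatMap encRat =
      (List.replicate m (encs fun _ : Fin 2 => 1)).flatten := by
    rw [ofFn_blk, List.flatMap_assoc, List.flatMap, List.map_const', List.length_finRange]
    rfl
  simp [cmpNet, encNet, encLayer, encNeuron, encVec, actStr, this]

theorem run_cmp (σ : A) {m : ℕ} {d : ℚ} {b : ℕ} {S : Stk → List Sym}
    (hn : S todo = List.replicate m .comma) (hS : S aux = []) (hs : S seen = [])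
    (ht : S thr = (encRat d).reverse) (hd : (encRat d).length ≤ b) (hm : m ≤ b) :
    Emits (cmpProg (actStr name σ)) acc S (100 * (b + 1) ^ 2) (encNet name (cmpNet σ m d)) := by
  rw [encNet_cmpNet]
  refine Emits.mono ((emits_bandLayer name σ cmpBand (fun (_ : Fin m) _ => d)
    (fun _ => .copy thr) (b := 5 * b + 6) hn hS hs (fun _ => by simp [Item.Reads])
    (fun _ => by simpa [Item.cost, ht]) (fun _ _ => by simp [Item.str, ht])).seq <|
    (emits_push ..).seq <| Emits.seq (s := (List.replicate m (encs fun _ : Fin 2 => 1)).flatten)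
    (t := 5 * m + 2) ?_ (emits_push ..)) ?_
  · have := emits_rep (c := todo) (T := aux) (d := acc) (by decide) (by decide) (by decide)
      (S := app (app S acc (encLayer name (bandLayer σ cmpBand fun (_ : Fin m) _ => d))) acc
        (actStr name σ ++ encRat 0)) (by simpa [app]) (encs fun _ : Fin 2 => 1)
    simpa [app_of_ne, hn] using this
  · have h2 : m * (2 * (5 * b + 6 + 5 * m + 7) + 5) ≤
        b * (2 * (5 * b + 6 + 5 * b + 7) + 5) := by gcongr
    nlinarith

/-- The program that computes `mapSR`. -/
noncomputable def stdProg (p : ENNReal) (pre : List Sym) : Prog Stk :=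
  centerProg ;; push acc [.infty] ;; tolProg p fun T =>
    outTolProg p ;; ballProg pre T T.band₄ ![1, -1, 1, -1] ;;
    (layerProg [1, -1, 0, 0] (some [0, 0, 1, -1]) ;; doubleProg) ;;
    (clear todo ;; move width todo) ;; cmpProg pre ;; clear rad ;; clear todo ;; clear thr

theorem length_cmpBias_le (p : ENNReal) (δ : WithTop NNRat) :
    (encRat (cmpBias p δ)).length ≤ 4 * (encTol δ).length := by
  have h1 := length_encTol_pos δ
  have h2 := length_tolRat_le δ
  unfold cmpBias
  split_ifs
  · simp [encRat_zero]; omega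
  · rwa [encRat_neg, length_negStr]

theorem outDim_le {n m : ℕ} (N : Net A n m) : m ≤ (encNet name N).length := by
  induction N with
  | output layer =>
    have := length_lt_encLayer name layer
    simp only [encNet, List.length_append]
    omega
  | hidden layer rest ih =>
    simp only [encNet, List.length_append]
    omega

theorem run_std (p : ENNReal) (σ : A) {n m : ℕ} (N : Net A n m) (ε δ : WithTop NNRat)
    (c : Fin n → ℚ) {L : ℕ}
    (hL : L = (encVec c ++ encTol ε ++ encTol δ ++ encNet name N).length) :
    Run (stdProg p (actStr name σ)) (only inp (encVec c ++ encTol ε ++ encTol δ ++ encNet name N))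
      (20000 * (L + 1) ^ 2) (only acc (encVec (fun _ : Fin (n * 1) => 0) ++ encTol ⊤ ++
        encTol (mapTol p δ) ++ encNet name ((tolMap p ε).net σ (tolRat ε) (tolMap p ε).band₄
          ![1, -1, 1, -1] c (N.doublePairs (cmpNet σ m (cmpBias p δ))))).reverse) := by
  obtain ⟨hn, hc⟩ := length_le_encVec c
  have hε := length_tolRat_le ε
  have hδ := length_cmpBias_le p δ
  simp only [List.length_append] at hL
  set S₀ := only inp (encVec c ++ encTol ε ++ encTol δ ++ encNet name N)
  have h1 := run_center (c := c) (S := S₀) (rest := encTol ε ++ (encTol δ ++ encNet name N))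
    (by simp [S₀, only]) (by simp [S₀, only]) (by simp [S₀, only]) (by simp [S₀, only])
  set S₁ := app (update (update (update S₀ inp (encTol ε ++ (encTol δ ++ encNet name N))) cen
    ((List.ofFn c).flatMap encRat)) todo (List.replicate n .comma)) acc
    (encVec fun _ : Fin (n * 1) => 0) with hS₁
  set S₂ := app S₁ acc [.infty] with hS₂
  set S₃ := app (update S₂ inp (encTol δ ++ encNet name N)) rad (encRat (tolRat ε)) with hS₃
  have h3 := run_outTol (p := p) (δ := δ) (rest := encNet name N) (S := S₃)
    (by simp [S₃, S₂, S₁, S₀, app, only]) (by simp [S₃, S₂, S₁, S₀, app, only])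
    (by simp [S₃, S₂, S₁, app])
  set S₄ := app (app (update S₃ inp (encNet name N)) acc (encTol (mapTol p δ))) thr
    (encRat (cmpBias p δ)) with hS₄
  obtain ⟨l, hl, h4⟩ := run_ball name σ (tolMap p ε) (by norm_num) (tolMap p ε).band₄
    ![1, -1, 1, -1] (c := c) (β := tolRat ε) (N.doublePairs (cmpNet σ m (cmpBias p δ))) (S := S₄)
    (b := 4 * L) (by simp [S₄, S₃, S₂, S₁, app])
    (by simp [S₄, S₃, S₂, S₁, S₀, app, only]) (by simp [S₄, S₃, S₂, S₁, S₀, app, only])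
    (by simp [S₄, S₃, S₂, S₁, S₀, app, only]) (by simp [S₄, S₃, S₂, S₁, app])
    (by simp [S₄, S₃, S₂, S₁, S₀, app, only]) (by omega) (fun i => (hc i).trans (by omega))
    (by omega)
  set S₅ := app (update S₄ cen []) acc l with hS₅
  obtain ⟨l', hl', h5⟩ := run_doublePairs name N (S := S₅)
    (by simp [S₅, S₄, S₃, S₂, S₁, S₀, app, only]) (by simp [S₅, S₄, S₃, S₂, S₁, S₀, app, only])
    (by simp [S₅, S₄, S₃, S₂, S₁, S₀, app, only]) (by simp [S₅, S₄, S₃, S₂, S₁, S₀, app, only])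
    (by simp [S₅, S₄, app])
  set S₆ := app (app (update S₅ inp []) acc l') width (List.replicate m .comma) with hS₆
  set S₇ := update (update S₆ width []) todo (List.replicate m .comma) with hS₇
  have h6 : Run (clear todo ;; move width todo) S₆ (2 * n + 2 * m + 2) S₇ := by
    refine (Run.seq (run_clear _ _) (run_move (by decide) _)).congr ?_ ?_
    · ext1 k
      cases k <;> simp [S₇, S₆, S₅, S₄, S₃, S₂, S₁, S₀, app, only]
    · simp [S₆, S₅, S₄, S₃, S₂, S₁, S₀, app, only]
      omega
  have hm := outDim_le name N
  have h7 := run_cmp name σ (m := m) (d := cmpBias p δ) (b := 4 * L) (S := S₇)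
    (by simp [S₇]) (by simp [S₇, S₆, S₅, S₄, S₃, S₂, S₁, S₀, app, only])
    (by simp [S₇, S₆, S₅, S₄, S₃, S₂, S₁, S₀, app, only])
    (by simp [S₇, S₆, S₅, S₄, S₃, S₂, S₁, S₀, app, only]) (by omega) (by omega)
  refine (Run.seq h1 <| .seq (.push (S := S₁)) <| run_tol (S := S₂)
    (rest := encTol δ ++ encNet name N) (by simp [S₂, S₁, app]) (.seq h3 <| .seq h4 <|
    .seq h5 <| .seq h6 <| .seq h7 <| .seq (run_clear _ _) <| .seq (run_clear _ _) <|
    run_clear _ _)).congr ?_ ?_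
  · rw [hl, hl']
    ext1 k
    cases k <;> simp [S₇, S₆, S₅, S₄, S₃, S₂, S₁, S₀, app, only, encTol]
  · simp [S₇, S₆, S₅, S₄, S₃, S₂, S₁, S₀, app, only, -List.length_flatMap]
    nlinarith

theorem polyTime_mapCR (p : ENNReal) (σ : A) :
    Nonempty (TM2ComputableInPolyTime (encCR name) (encCR name) (mapCR p σ)) :=
  nonempty_polyTime_of_run (classProg p (actStr name σ)) 20000 fun I =>
    run_class name p σ I.net I.eps I.center (encNat I.label) rfl

theorem polyTime_mapACR (p : ENNReal) (σ : A) :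
    Nonempty (TM2ComputableInPolyTime (encACR name) (encACR name) (mapACR p σ)) := by
  refine nonempty_polyTime_of_run (classProg p (actStr name σ)) 20000 fun I => ?_
  have := run_class name p σ I.net I.eps I.center [] rfl
  simp only [List.append_nil] at this
  exact this

theorem polyTime_mapSR (p : ENNReal) (σ : A) :
    Nonempty (TM2ComputableInPolyTime (encSR name) (encSR name) (mapSR p σ)) :=
  nonempty_polyTime_of_run (stdProg p (actStr name σ)) 20000 fun I =>
    run_std name p σ I.net I.eps I.delta I.center rfl

end Net

end Prog
end NeuralNet

/-! ### The functions computed by the constructed networks. -/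

namespace NeuralNet

open Function

section Eval

variable {F : Set (ℝ → ℝ)}

theorem sum_band {n : ℕ} (k : Fin n) (a b : Fin n → ℝ) :
    ∑ k', (if k' < k then a k' else if k' = k then b k' else 0) =
      ∑ k' with k' < k, a k' + b k := by
  have : ∀ k', (if k' < k then a k' else if k' = k then b k' else 0) =
      (if k' < k then a k' else 0) + if k' = k then b k' else 0 := by
    intro k'
    rcases lt_trichotomy k' k with h | h | h
    · simp [h, h.ne]
    · simp [h]
    · simp [h.not_gt, h.ne']
  simp [this, Finset.sum_add_distrib, Finset.sum_filter]

theorem Net.eval_hidden {n k m : ℕ} (layer : Fin k → Neuron F n) (rest : Net F k m)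
    (x : Fin n → ℝ) : (Net.hidden layer rest).eval x = rest.eval fun i => (layer i).eval x :=
  rfl

theorem eval_bandLayer {n r c : ℕ} (σ : F) (B : Band r c) (bias : Fin n → Fin r → ℚ)
    (y : Fin (n * c) → ℝ) (k : Fin n) (ρ : Fin r) :
    (bandLayer σ B bias (finProdFinEquiv (k, ρ))).eval y =
      (σ : ℝ → ℝ) (∑ k' : Fin n with k' < k, ∑ γ : Fin c, (B.below ρ γ : ℝ) * y (finProdFinEquiv (k', γ)) +
        ∑ γ, (B.diag ρ γ : ℝ) * y (finProdFinEquiv (k, γ)) + bias k ρ) := by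
  rw [bandLayer, blk_apply, Neuron.eval, sum_blk, ← sum_band k
    (fun k' : Fin n => ∑ γ : Fin c, (B.below ρ γ : ℝ) * y (finProdFinEquiv (k', γ)))
    (fun k' : Fin n => ∑ γ : Fin c, (B.diag ρ γ : ℝ) * y (finProdFinEquiv (k', γ)))]
  refine congrArg _ (congrArg (· + _) (Finset.sum_congr rfl fun k' _ => ?_))
  simp only [blk_apply]
  split_ifs <;> simp

theorem eval_expand {n c : ℕ} (σ : Fin c → SignType) (u : Neuron F n) (y : Fin n → Fin c → ℝ) :
    (u.expand σ).eval (blk y) = u.eval fun j => ∑ γ : Fin c, (σ γ : ℝ) * y j γ := by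
  simp only [Neuron.eval, Neuron.expand, sum_blk, blk_apply, Finset.mul_sum]
  refine congrArg _ (congrArg (· + _) (Finset.sum_congr rfl fun j _ =>
    Finset.sum_congr rfl fun γ _ => ?_))
  rcases σ γ with _ | _ | _ <;> simp

theorem eval_pairs {n m : ℕ} (N : Net F n m) (u v : Fin n → ℝ) :
    N.pairs.eval (blk fun k => ![u k, v k]) = N.eval fun k => u k - v k := by
  have h : ∀ {q : ℕ} (layer : Fin q → Neuron F n), (fun i => ((layer i).expand ![1, -1]).eval
      (blk fun k => ![u k, v k])) = fun i => (layer i).eval fun k => u k - v k := by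
    intro q layer
    funext i
    rw [eval_expand]
    simp [Fin.sum_univ_two, sub_eq_add_neg]
  cases N with
  | output layer => exact h layer
  | hidden layer rest => exact congrArg rest.eval (h layer)

theorem eval_dupLayer {n k c : ℕ} (σ : Fin 2 → Fin c → SignType) (layer : Fin k → Neuron F n)
    (y : Fin n → Fin c → ℝ) {a b : Fin n → ℝ} (ha : ∀ j, ∑ γ, (σ 0 γ : ℝ) * y j γ = a j)
    (hb : ∀ j, ∑ γ, (σ 1 γ : ℝ) * y j γ = b j) :
    (fun i => (dupLayer σ layer i).eval (blk y)) =
      blk fun i => ![(layer i).eval a, (layer i).eval b] := by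
  funext i
  revert i
  rw [forall_blk]
  intro i j
  rw [dupLayer, blk_apply, blk_apply, eval_expand]
  fin_cases j
  · simp [ha]
  · simp [hb]

theorem eval_double {n m q : ℕ} (N : Net F n m) (fin : Net F (m * 2) q) (a b : Fin n → ℝ) :
    (N.double fin).eval (blk fun k => ![a k, b k]) =
      fin.eval (blk fun i => ![N.eval a i, N.eval b i]) := by
  induction N with
  | output layer =>
    rw [Net.double, Net.eval_hidden, eval_dupLayer (a := a) (b := b) _ _ _ (by simp) (by simp)]
    rfl
  | hidden layer rest ih =>
    rw [Net.double, Net.eval_hidden, eval_dupLayer (a := a) (b := b) _ _ _ (by simp) (by simp), ih]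
    rfl

theorem eval_doublePairs {n m q : ℕ} (N : Net F n m) (fin : Net F (m * 2) q)
    (u v u' v' : Fin n → ℝ) :
    (N.doublePairs fin).eval (blk fun k => ![u k, v k, u' k, v' k]) =
      fin.eval (blk fun i => ![N.eval (fun k => u k - v k) i,
        N.eval (fun k => u' k - v' k) i]) := by
  cases N with
  | output layer =>
    rw [Net.doublePairs, Net.eval_hidden, eval_dupLayer (a := fun k => u k - v k)
      (b := fun k => u' k - v' k) _ _ _ (by simp [Fin.sum_univ_four, sub_eq_add_neg])
      (by simp [Fin.sum_univ_four, sub_eq_add_neg])]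
    rfl
  | hidden layer rest =>
    rw [Net.doublePairs, Net.eval_hidden, eval_dupLayer (a := fun k => u k - v k)
      (b := fun k => u' k - v' k) _ _ _ (by simp [Fin.sum_univ_four, sub_eq_add_neg])
      (by simp [Fin.sum_univ_four, sub_eq_add_neg]), eval_double]
    rfl

theorem relu_sub_relu_neg (x : ℝ) : relu x - relu (-x) = x := by
  unfold relu
  rcases le_total 0 x with h | h
  · rw [max_eq_right h, max_eq_left (by linarith), sub_zero]
  · rw [max_eq_left h, max_eq_right (by linarith)]; ring

theorem relu_add_relu_neg (x : ℝ) : relu x + relu (-x) = |x| := by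
  unfold relu
  rcases le_total 0 x with h | h
  · rw [max_eq_right h, max_eq_left (by linarith), abs_of_nonneg h, add_zero]
  · rw [max_eq_left h, max_eq_right (by linarith), abs_of_nonpos h, zero_add]

/-- The positive and negative part of a real number. -/
noncomputable def parts (x : ℝ) : Fin 2 → ℝ := ![relu x, relu (-x)]

/-- The values in the middle layer of a ball map. -/
noncomputable def BallMap.mid {n : ℕ} (T : BallMap) (β : ℝ) (x : Fin n → ℝ) (k : Fin n)
    (ρ : Fin 3) : ℝ :=
  relu (∑ k' : Fin n with k' < k, ∑ γ, (T.middle.below ρ γ : ℝ) * parts (x k') γ +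
    ∑ γ, (T.middle.diag ρ γ : ℝ) * parts (x k) γ + β)

/-- The point of the ball (with center `0`) to which `x` is mapped. -/
noncomputable def BallMap.point {n : ℕ} (T : BallMap) (β : ℝ) (x : Fin n → ℝ) (k : Fin n) : ℝ :=
  ∑ γ, (T.last γ : ℝ) * T.mid β x k γ

/-- The entries of a vector of blocks of size one. -/
def unblk {n : ℕ} (x : Fin (n * 1) → ℝ) (k : Fin n) : ℝ := x (finProdFinEquiv (k, 0))

/-- The third layer has no blocks below the diagonal, so coordinates interact in the middle layer
only. -/
theorem eval_ballNet {n r m : ℕ} (T : BallMap) {σ : F} (hσ : (σ : ℝ → ℝ) = relu) (β : ℚ)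
    (D : Fin r → Fin 3 → ℚ) (s : Fin r → SignType) (c : Fin n → ℚ) (N : Net F (n * r) m)
    (x : Fin (n * 1) → ℝ) : (T.net σ β ⟨0, D⟩ s c N).eval x =
      N.eval (blk fun k ρ => relu (∑ γ, (D ρ γ : ℝ) * T.mid β (unblk x) k γ + (s ρ : ℝ) * c k)) := by
  have h1 : (fun i => (bandLayer σ partsBand (fun (_ : Fin n) _ => 0) i).eval x) =
      blk fun k => parts (unblk x k) := by
    funext i
    revert i
    rw [forall_blk]
    intro k ρ
    rw [eval_bandLayer, hσ, blk_apply]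
    fin_cases ρ <;> simp [partsBand, parts, unblk]
  have h2 : (fun i => (bandLayer σ T.middle (fun (_ : Fin n) _ => β) i).eval
      (blk fun k => parts (unblk x k))) = blk (T.mid β (unblk x)) := by
    funext i
    revert i
    rw [forall_blk]
    intro k ρ
    rw [eval_bandLayer, hσ, blk_apply]
    simp only [blk_apply]
    rfl
  have h3 : (fun i => (bandLayer σ ⟨0, D⟩ (fun k ρ => (s ρ : ℚ) * c k) i).eval
      (blk (T.mid β (unblk x)))) =
      blk fun k ρ => relu (∑ γ, (D ρ γ : ℝ) * T.mid β (unblk x) k γ + (s ρ : ℝ) * c k) := by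
    funext i
    revert i
    rw [forall_blk]
    intro k ρ
    rw [eval_bandLayer, hσ, blk_apply]
    rcases s ρ with _ | _ | _ <;> simp
  rw [BallMap.net, Net.eval_hidden, h1, Net.eval_hidden, h2, Net.eval_hidden, h3]

/-- The last ball layer outputs the positive and the negative part of each shifted coordinate; the
signed weights of `N.pairs` recombine them by `relu_sub_relu_neg`. -/
theorem eval_ballNet_pairs {n m : ℕ} (T : BallMap) {σ : F} (hσ : (σ : ℝ → ℝ) = relu) (β : ℚ)
    (c : Fin n → ℚ) (N : Net F n m) (x : Fin (n * 1) → ℝ) :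
    (T.net σ β T.band₂ ![1, -1] c N.pairs).eval x =
      N.eval fun k => realPoint c k + T.point β (unblk x) k := by
  rw [BallMap.band₂, eval_ballNet T hσ]
  have : (fun (k : Fin n) ρ => relu (∑ γ, (((![T.last, -T.last] : Fin 2 → Fin 3 → ℚ) ρ γ : ℚ) : ℝ) *
      T.mid β (unblk x) k γ + ((![1, -1] : Fin 2 → SignType) ρ : ℝ) * c k)) = fun k =>
      ![relu (T.point β (unblk x) k + c k), relu (-(T.point β (unblk x) k + c k))] := by
    funext k ρ
    fin_cases ρ
    · simp [BallMap.point]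
    · simp [BallMap.point, add_comm]
  rw [this, eval_pairs]
  simp only [relu_sub_relu_neg, realPoint, add_comm]

/-- The two zero rows of `band₄` pass on only the bias, that is, the parts of the center, so the
second copy of `N` is always evaluated at the center. -/
theorem eval_ballNet_doublePairs {n m q : ℕ} (T : BallMap) {σ : F} (hσ : (σ : ℝ → ℝ) = relu)
    (β : ℚ) (c : Fin n → ℚ) (N : Net F n m) (fin : Net F (m * 2) q) (x : Fin (n * 1) → ℝ) :
    (T.net σ β T.band₄ ![1, -1, 1, -1] c (N.doublePairs fin)).eval x =
      fin.eval (blk fun i => ![N.eval (fun k => realPoint c k + T.point β (unblk x) k) i,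
        N.eval (realPoint c) i]) := by
  rw [BallMap.band₄, eval_ballNet T hσ]
  have : (fun (k : Fin n) ρ => relu (∑ γ,
      (((![T.last, -T.last, 0, 0] : Fin 4 → Fin 3 → ℚ) ρ γ : ℚ) : ℝ) *
      T.mid β (unblk x) k γ + ((![1, -1, 1, -1] : Fin 4 → SignType) ρ : ℝ) * c k)) = fun k =>
      ![relu (T.point β (unblk x) k + c k), relu (-(T.point β (unblk x) k + c k)),
        relu (c k), relu (-c k)] := by
    funext k ρ
    fin_cases ρ
    · simp [BallMap.point]
    · simp [BallMap.point, add_comm]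
    · simp
    · simp
  rw [this, eval_doublePairs]
  simp only [relu_sub_relu_neg, add_comm]
  rfl

theorem eval_cmpNet {σ : F} (hσ : (σ : ℝ → ℝ) = relu) {m : ℕ} (d : ℚ) (a b : Fin m → ℝ)
    (j : Fin 1) : (cmpNet σ m d).eval (blk fun i => ![a i, b i]) j =
      ∑ i, (relu (a i - b i + d) + relu (b i - a i + d)) := by
  have h1 : (fun i => (bandLayer σ cmpBand (fun (_ : Fin m) _ => d) i).eval
      (blk fun i => ![a i, b i])) =
      blk fun i => ![relu (a i - b i + d), relu (b i - a i + d)] := by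
    funext i
    revert i
    rw [forall_blk]
    intro i ρ
    rw [eval_bandLayer, hσ, blk_apply]
    fin_cases ρ
    · simp [cmpBand, Fin.sum_univ_two, sub_eq_add_neg]
    · simp [cmpBand, Fin.sum_univ_two, sub_eq_add_neg, add_comm]
  rw [cmpNet, Net.eval_hidden, h1, Net.eval, Neuron.eval, hσ, sum_blk]
  simp only [blk_apply, Fin.sum_univ_two]
  -- The output node sums nonnegative numbers, so its own ReLU acts as the identity.
  rw [relu, max_eq_right]
  · simp
  · have : ∀ x, 0 ≤ relu x := fun x => le_max_left _ _
    simpa using Finset.sum_nonneg fun i _ => add_nonneg (this _) (this _)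

end Eval

end NeuralNet

/-! ### Distances, and the piecewise linear maps onto balls. -/

namespace NeuralNet

open Function

section Dist

theorem lpDist_one {n : ℕ} (x y : Fin n → ℝ) : lpDist 1 x y = ∑ i, |x i - y i| := by
  simp [lpDist, PiLp.dist_eq_of_L1, Real.dist_eq]

/-- Nonnegativity of `r` covers `n = 0`, where the supremum is `0`. -/
theorem lpDist_top_le {n : ℕ} (x y : Fin n → ℝ) {r : ℝ} (hr : 0 ≤ r) :
    lpDist ⊤ x y ≤ r ↔ ∀ i, |x i - y i| ≤ r := by
  rw [lpDist, PiLp.dist_eq_iSup]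
  refine ⟨fun h i => ?_, fun h => Real.iSup_le h hr⟩
  exact (le_ciSup (f := fun i => dist (x i) (y i)) (Set.finite_range _).bddAbove i).trans h

theorem lpDist_fin_one {p : ENNReal} (hp : 1 ≤ p) (x y : Fin 1 → ℝ) :
    lpDist p x y = |x 0 - y 0| := by
  rcases eq_or_ne p ⊤ with rfl | hp'
  · rw [lpDist, PiLp.dist_eq_iSup, ciSup_unique]
    rfl
  · have h : 0 < p.toReal := ENNReal.toReal_pos (by positivity) hp'
    rw [lpDist, PiLp.dist_eq_sum h]
    simp only [Fin.sum_univ_one]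
    rw [← Real.rpow_mul dist_nonneg, mul_one_div_cancel h.ne', Real.rpow_one]
    rfl

theorem withinTol_top (r : ℝ) : WithinTol r ⊤ := fun _ h => (WithTop.top_ne_coe h).elim

theorem withinTol_coe (r : ℝ) (q : NNRat) : WithinTol r (q : WithTop NNRat) ↔ r ≤ q :=
  ⟨fun h => h q rfl, fun h _ h' => WithTop.coe_injective h' ▸ h⟩

end Dist

section Ball

theorem point_free {n : ℕ} (x : Fin n → ℝ) : freeMap.point 0 x = x := by
  funext k
  have h : ∀ y, relu (relu y) = relu y := fun y => max_eq_right (le_max_left _ _)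
  simp [BallMap.point, BallMap.mid, freeMap, Fin.sum_univ_three, parts, h,
    ← sub_eq_add_neg, relu_sub_relu_neg]

theorem relu_of_nonneg {x : ℝ} (h : 0 ≤ x) : relu x = x := max_eq_right h

theorem relu_of_nonpos {x : ℝ} (h : x ≤ 0) : relu x = 0 := max_eq_left h

theorem relu_nonneg (x : ℝ) : 0 ≤ relu x := le_max_left _ _

theorem point_box {n : ℕ} (β : ℝ) (x : Fin n → ℝ) (k : Fin n) :
    (ballMap ⊤).point β x k = relu (β - relu (-x k)) - relu (β - relu (x k)) := by
  simp [BallMap.point, BallMap.mid, ballMap, Fin.sum_univ_three, parts, ← sub_eq_add_neg]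
  ring_nf

/-- A difference of two numbers in `[0, β]`. -/
theorem abs_point_box_le {n : ℕ} {β : ℝ} (hβ : 0 ≤ β) (x : Fin n → ℝ) (k : Fin n) :
    |(ballMap ⊤).point β x k| ≤ β := by
  have h : ∀ y, 0 ≤ relu (β - relu y) ∧ relu (β - relu y) ≤ β := fun y =>
    ⟨relu_nonneg _, max_le hβ (by have := relu_nonneg y; linarith)⟩
  rw [point_box, abs_le]
  constructor <;> linarith [h (x k), h (-x k)]

/-- Both parts of `x k` are at most `β`, so the outer ReLUs are inactive and `β` cancels. -/
theorem point_box_eq {n : ℕ} {β : ℝ} {x : Fin n → ℝ} {k : Fin n} (h : |x k| ≤ β) :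
    (ballMap ⊤).point β x k = x k := by
  have h' := relu_add_relu_neg (x k)
  have h₁ := relu_nonneg (x k)
  have h₂ := relu_nonneg (-x k)
  have e₁ : relu (β - relu (x k)) = β - relu (x k) := relu_of_nonneg (by linarith)
  have e₂ : relu (β - relu (-x k)) = β - relu (-x k) := relu_of_nonneg (by linarith)
  rw [point_box, e₁, e₂]
  linarith [relu_sub_relu_neg (x k)]

/-- The sum of the first absolute values. -/
noncomputable def absSum {n : ℕ} (x : Fin n → ℝ) (j : ℕ) : ℝ := ∑ i : Fin n with i.val < j, |x i|

theorem absSum_succ {n : ℕ} (x : Fin n → ℝ) (k : Fin n) :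
    absSum x (k + 1) = absSum x k + |x k| := by
  have : (Finset.univ.filter fun i : Fin n => i.val < k + 1) =
      insert k (Finset.univ.filter fun i : Fin n => i.val < k) := by
    ext i
    simp [Fin.ext_iff]
    omega
  rw [absSum, this, Finset.sum_insert (by simp), add_comm]
  rfl

theorem point_cross {n : ℕ} (β : ℝ) (x : Fin n → ℝ) (k : Fin n) :
    (ballMap 1).point β x k = relu (β - absSum x k) -
      2 * relu (β - absSum x k - relu (x k)) + relu (β - absSum x (k + 1)) := by
  have h : ∑ k' with k' < k, (-relu (x k') + -relu (-x k')) = -absSum x k := by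
    rw [absSum, ← Finset.sum_neg_distrib]
    refine Finset.sum_congr (by ext; simp) fun i _ => ?_
    rw [← relu_add_relu_neg]
    ring
  rw [absSum_succ, ← relu_add_relu_neg (x k)]
  simp only [BallMap.point, BallMap.mid, ballMap, Fin.sum_univ_three, parts, Fin.sum_univ_two]
  simp [h]
  ring_nf

/-- In the combination with coefficients `1, -2, 1` of `point_cross`, the middle term equals the
third one if `x k ≥ 0` and the first one if `x k ≤ 0`. What remains is, up to the sign of `x k`, the
drop of the remaining budget. -/
theorem abs_point_cross {n : ℕ} (β : ℝ) (x : Fin n → ℝ) (k : Fin n) :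
    |(ballMap 1).point β x k| = relu (β - absSum x k) - relu (β - absSum x (k + 1)) ∧
      0 ≤ x k * (ballMap 1).point β x k := by
  have hm : ∀ {a b : ℝ}, a ≤ b → relu a ≤ relu b := fun h => max_le_max le_rfl h
  have hd := hm (a := β - absSum x (k + 1)) (b := β - absSum x k)
    (by rw [absSum_succ]; linarith [abs_nonneg (x k)])
  rw [point_cross]
  rcases le_total 0 (x k) with h | h
  · have : β - absSum x k - relu (x k) = β - absSum x (k + 1) := by
      rw [absSum_succ, relu_of_nonneg h, abs_of_nonneg h]; ring
    rw [this]
    constructor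
    · rw [abs_of_nonneg (by linarith)]; ring
    · exact mul_nonneg h (by linarith)
  · rw [relu_of_nonpos h, sub_zero]
    constructor
    · rw [abs_of_nonpos (by linarith)]; ring
    · exact mul_nonneg_of_nonpos_of_nonpos h (by linarith)

/-- The budget drops telescope from `β` to a nonnegative remainder. -/
theorem sum_abs_point_cross_le {n : ℕ} {β : ℝ} (hβ : 0 ≤ β) (x : Fin n → ℝ) :
    ∑ k, |(ballMap 1).point β x k| ≤ β := by
  simp only [(abs_point_cross β x _).1]
  rw [Fin.sum_univ_eq_sum_range (fun k => relu (β - absSum x k) - relu (β - absSum x (k + 1))),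
    Finset.sum_range_sub']
  have h : absSum x 0 = 0 := by simp [absSum]
  rw [h, sub_zero, relu_of_nonneg hβ]
  linarith [relu_nonneg (β - absSum x n)]

/-- Inside the ball the budget is never exhausted, so each drop is exactly `|x k|`. -/
theorem point_cross_eq {n : ℕ} {β : ℝ} {x : Fin n → ℝ} (h : ∑ k, |x k| ≤ β) :
    (ballMap 1).point β x = x := by
  have hS : ∀ j, absSum x j ≤ β := fun j =>
    (Finset.sum_le_sum_of_subset_of_nonneg (Finset.filter_subset _ _)
      fun i _ _ => abs_nonneg (x i)).trans h
  funext k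
  obtain ⟨h1, h2⟩ := abs_point_cross β x k
  rw [relu_of_nonneg (by linarith [hS k]), relu_of_nonneg (by linarith [hS (k + 1)]),
    absSum_succ] at h1
  have h1' : |(ballMap 1).point β x k| = |x k| := by linarith
  rcases abs_eq_abs.mp h1' with h' | h'
  · exact h'
  · rw [h'] at h2 ⊢
    -- The image has the opposite sign only if `-(x k)² ≥ 0`.
    have : x k = 0 := by nlinarith
    rw [this, neg_zero]

theorem withinTol_point {p : ENNReal} (hp : p = 1 ∨ p = ⊤) {n : ℕ} (ε : WithTop NNRat) (c x : Fin n → ℝ) :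
    WithinTol (lpDist p (fun k => c k + (tolMap p ε).point (tolRat ε) x k) c) ε := by
  cases ε with
  | top => exact withinTol_top _
  | coe q =>
    rw [withinTol_coe]
    change lpDist p (fun k => c k + (ballMap p).point ((q : ℚ) : ℝ) x k) c ≤ ((q : ℚ) : ℝ)
    have hq : (0 : ℝ) ≤ ((q : ℚ) : ℝ) := by exact_mod_cast q.2
    rcases hp with rfl | rfl
    · rw [lpDist_one]
      simpa using sum_abs_point_cross_le hq x
    · rw [lpDist_top_le _ _ hq]
      simpa using abs_point_box_le hq x

theorem exists_point {p : ENNReal} (hp : p = 1 ∨ p = ⊤) {n : ℕ} {ε : WithTop NNRat} {c y : Fin n → ℝ}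
    (h : WithinTol (lpDist p y c) ε) :
    (fun k => c k + (tolMap p ε).point (tolRat ε) (fun k => y k - c k) k) = y := by
  have key : (tolMap p ε).point (tolRat ε) (fun k => y k - c k) = fun k => y k - c k := by
    cases ε with
    | top =>
      have := point_free (fun k => y k - c k)
      rwa [← Rat.cast_zero] at this
    | coe q =>
      rw [withinTol_coe] at h
      change lpDist p y c ≤ ((q : ℚ) : ℝ) at h
      change (ballMap p).point ((q : ℚ) : ℝ) _ = _
      have hq : (0 : ℝ) ≤ ((q : ℚ) : ℝ) := by exact_mod_cast q.2
      rcases hp with rfl | rfl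
      · rw [lpDist_one] at h
        exact point_cross_eq h
      · rw [lpDist_top_le _ _ hq] at h
        exact funext fun k => point_box_eq (h k)
  rw [key]
  simp

/-- The shifted ball map takes all its values in the ball, and every `y` in the ball is the image of
`y - c`. -/
theorem forall_withinTol {p : ENNReal} (hp : p = 1 ∨ p = ⊤) {n : ℕ} {ε : WithTop NNRat} {c : Fin n → ℝ} {P : (Fin n → ℝ) → Prop} :
    (∀ y, WithinTol (lpDist p y c) ε → P y) ↔
      ∀ x : Fin (n * 1) → ℝ, P fun k => c k + (tolMap p ε).point (tolRat ε) (unblk x) k := by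
  refine ⟨fun h x => h _ (withinTol_point hp ε c _), fun h y hy => ?_⟩
  have := h (blk fun k _ => y k - c k)
  rw [show unblk (blk fun k _ => y k - c k) = fun k => y k - c k from
    funext fun k => by simp [unblk], exists_point hp hy] at this
  exact this

/-- `0` lies in every ball about `0` and is therefore fixed: the new center `0` is sent to the old
one. -/
theorem point_zero {p : ENNReal} (hp : p = 1 ∨ p = ⊤) {n : ℕ} (ε : WithTop NNRat) :
    (tolMap p ε).point (tolRat ε) (fun _ : Fin n => 0) = fun _ => 0 := by
  have := exists_point hp (n := n) (ε := ε) (c := fun _ => 0) (y := fun _ => 0) (by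
    cases ε with
    | top => exact withinTol_top _
    | coe q =>
      have hq : (0 : ℝ) ≤ q := by exact_mod_cast q.2
      rw [withinTol_coe]
      rcases hp with rfl | rfl
      · simpa [lpDist_one] using hq
      · exact (lpDist_top_le _ _ hq).2 fun i => by simpa using hq)
  simpa using this

end Ball

end NeuralNet

/-! ### Equivalence of the instances. -/

namespace NeuralNet

open Function

section Reductions

variable {F : Set (ℝ → ℝ)}

/-- With infinite tolerance the condition on the distance is void, hence `lam` is arbitrary. -/
theorem classRobust_iff {σ : F} (hσ : (σ : ℝ → ℝ) = relu) {p : ENNReal}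
    (hp : p = 1 ∨ p = ⊤) (lam : ENNReal) {n m : ℕ} (N : Net F n m) (ε : WithTop NNRat) (c : Fin n → ℚ)
    (j : Fin m) : ClassRobust p N ε c j ↔ ClassRobust lam ((tolMap p ε).net σ (tolRat ε)
      (tolMap p ε).band₂ ![1, -1] c N.pairs) ⊤ (fun _ => 0) j := by
  rw [ClassRobust, ClassRobust,
    forall_withinTol hp (P := fun x => ∀ i, N.eval x i ≤ N.eval x j)]
  simp only [eval_ballNet_pairs _ hσ]
  exact forall_congr' fun x => (imp_iff_right (withinTol_top _)).symm

theorem cR_iff {σ : F} (hσ : (σ : ℝ → ℝ) = relu) {p : ENNReal}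
    (hp : p = 1 ∨ p = ⊤) (lam : ENNReal) (I : CRInstance F) : CR p I ↔ CR lam (mapCR p σ I) :=
  classRobust_iff hσ hp lam ..

theorem aCR_iff {σ : F} (hσ : (σ : ℝ → ℝ) = relu) {p : ENNReal}
    (hp : p = 1 ∨ p = ⊤) (lam : ENNReal) (I : ACRInstance F) : ACR p I ↔ ACR lam (mapACR p σ I) :=
  exists_congr fun _ => classRobust_iff hσ hp lam ..

/-- The output of the comparison layers on two vectors. -/
noncomputable def excess {m : ℕ} (d : ℚ) (a b : Fin m → ℝ) : ℝ :=
  ∑ i, (relu (a i - b i + d) + relu (b i - a i + d))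

theorem excess_nonneg {m : ℕ} (d : ℚ) (a b : Fin m → ℝ) : 0 ≤ excess d a b :=
  Finset.sum_nonneg fun _ _ => add_nonneg (relu_nonneg _) (relu_nonneg _)

theorem excess_self {m : ℕ} {d : ℚ} (hd : d ≤ 0) (a : Fin m → ℝ) : excess d a a = 0 := by
  have : (d : ℝ) ≤ 0 := by exact_mod_cast hd
  simp [excess, relu_of_nonpos this]

theorem cmpBias_nonpos (p : ENNReal) (δ : WithTop NNRat) : cmpBias p δ ≤ 0 := by
  unfold cmpBias
  split_ifs
  · exact le_rfl
  · cases δ with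
    | top => simp [tolRat]
    | coe q => simp [tolRat]

theorem relu_eq_zero_iff {x : ℝ} : relu x = 0 ↔ x ≤ 0 := max_eq_left_iff

/-- For `p = 1` the bias is `0` and `relu t + relu (-t) = |t|`. For `p = ⊤` and finite `δ` the
excess is a sum of nonnegative terms, which is at most `0` iff every term vanishes, that is, iff all
differences are at most `δ` in absolute value. -/
theorem withinTol_excess {p : ENNReal} (hp : p = 1 ∨ p = ⊤) {m : ℕ} (δ : WithTop NNRat) (a b : Fin m → ℝ) :
    WithinTol (excess (cmpBias p δ) a b) (mapTol p δ) ↔ WithinTol (lpDist p b a) δ := by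
  rcases hp with rfl | rfl
  · have : excess (cmpBias 1 δ) a b = lpDist 1 b a := by
      rw [lpDist_one, excess]
      refine Finset.sum_congr rfl fun i _ => ?_
      rw [← relu_add_relu_neg, neg_sub, add_comm]
      simp [cmpBias]
    rw [this, mapTol, if_pos rfl]
  · cases δ with
    | top => exact iff_of_true (withinTol_top _) (withinTol_top _)
    | coe q =>
      have hq : (0 : ℝ) ≤ q := by exact_mod_cast q.2
      rw [mapTol, if_neg ENNReal.top_ne_one, WithTop.map_coe, withinTol_coe, withinTol_coe,
        lpDist_top_le _ _ hq, NNRat.cast_zero, (excess_nonneg _ _ _).ge_iff_eq', excess,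
        Finset.sum_eq_zero_iff_of_nonneg fun _ _ => add_nonneg (relu_nonneg _) (relu_nonneg _)]
      have hd : ((cmpBias ⊤ (q : WithTop NNRat) : ℚ) : ℝ) = -q := by
        rw [cmpBias, if_neg ENNReal.top_ne_one]
        simp [tolRat]
      simp only [Finset.mem_univ, true_implies, hd]
      refine forall_congr' fun i => ?_
      rw [add_eq_zero_iff_of_nonneg (relu_nonneg _) (relu_nonneg _), relu_eq_zero_iff,
        relu_eq_zero_iff, abs_le]
      constructor
      · rintro ⟨h1, h2⟩
        constructor <;> linarith
      · rintro ⟨h1, h2⟩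
        constructor <;> linarith

/-- At input `0` both copies of `N` are evaluated at the center, and the excess is `0` because the
bias is not positive. Hence the distance of the one-dimensional outputs is the excess itself. -/
theorem sR_iff {σ : F} (hσ : (σ : ℝ → ℝ) = relu) {p : ENNReal}
    (hp : p = 1 ∨ p = ⊤) (lam : ENNReal) (hlam : 1 ≤ lam) (I : SRInstance F) :
    SR p I ↔ SR lam (mapSR p σ I) := by
  set M : Net F (I.inDim * 1) 1 := (tolMap p I.eps).net σ (tolRat I.eps) (tolMap p I.eps).band₄
    ![1, -1, 1, -1] I.center (I.net.doublePairs (cmpNet σ _ (cmpBias p I.delta))) with hM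
  have h : ∀ (x : Fin (I.inDim * 1) → ℝ) (j : Fin 1), M.eval x j =
      excess (cmpBias p I.delta) (I.net.eval fun k => realPoint I.center k +
        (tolMap p I.eps).point (tolRat I.eps) (unblk x) k) (I.net.eval (realPoint I.center)) := by
    intro x j
    rw [hM, eval_ballNet_doublePairs _ hσ, eval_cmpNet hσ]
    rfl
  have h0 : ∀ j : Fin 1, M.eval (realPoint fun _ => 0) j = 0 := by
    intro j
    rw [h, show unblk (realPoint fun _ : Fin (I.inDim * 1) => 0) = fun _ => 0 from
      funext fun _ => Rat.cast_zero, point_zero hp]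
    simp only [add_zero]
    exact excess_self (cmpBias_nonpos ..) _
  rw [SR, forall_withinTol hp (P := fun x =>
    WithinTol (lpDist p (I.net.eval (realPoint I.center)) (I.net.eval x)) I.delta)]
  refine forall_congr' fun x => ?_
  change _ ↔ (WithinTol _ ⊤ → WithinTol (lpDist lam (M.eval (realPoint fun _ => 0)) (M.eval x))
    (mapTol p I.delta))
  rw [← withinTol_excess hp, lpDist_fin_one hlam, h0, h, zero_sub, abs_neg,
    abs_of_nonneg (excess_nonneg _ _ _)]
  exact (imp_iff_right (withinTol_top _)).symm

end Reductions

end NeuralNet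

theorem mainTheorem11 (F : Set (ℝ → ℝ)) (hF : NeuralNet.relu ∈ F)
    (name : F → List Bool) (hname : Function.Injective name)
    (p : ENNReal) (hp : p = 1 ∨ p = ⊤) (lam : ENNReal) (hlam : 1 ≤ lam) :
    NeuralNet.PolyTimeReducible
        (NeuralNet.encCR name) (NeuralNet.CR p)
        (NeuralNet.encCR name) (NeuralNet.CR lam) ∧
      NeuralNet.PolyTimeReducible
        (NeuralNet.encACR name) (NeuralNet.ACR p)
        (NeuralNet.encACR name) (NeuralNet.ACR lam) ∧
      NeuralNet.PolyTimeReducible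
        (NeuralNet.encSR name) (NeuralNet.SR p)
        (NeuralNet.encSR name) (NeuralNet.SR lam) :=
  ⟨⟨_, NeuralNet.Prog.polyTime_mapCR name p ⟨_, hF⟩, NeuralNet.cR_iff rfl hp lam⟩,
    ⟨_, NeuralNet.Prog.polyTime_mapACR name p ⟨_, hF⟩, NeuralNet.aCR_iff rfl hp lam⟩,
    ⟨_, NeuralNet.Prog.polyTime_mapSR name p ⟨_, hF⟩, NeuralNet.sR_iff rfl hp lam hlam⟩⟩
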